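/- Let $G=\mathbb Z^d$ with $|i-j|=\sum_k|i_k-j_k|$, let $S^1=\mathbb R/2\pi\mathbb Z$ with Lebesgue measure $\lambda$, and let $\Phi=(\Phi_A)_{A\subset G\text{ finite}}$ be an absolutely summable potential on $(S^1)^G$: each $\Phi_A$ is a continuous real function of the spins in $A$, $\Phi$ is invariant under lattice translations and under joint rotation of all spins, and $\sum_{A\ni 0}\|\Phi_A\|_\infty<\infty$. Put $H_\Lambda=\sum_{A\cap\Lambda\ne\emptyset}\Phi_A$. For $q\ge1$ let $T:[0,2\pi)\to\{0,\dots,q-1\}$, $T(\varphi)=k$ iff $2\pi k/q\le\varphi<2\pi(k+1)/q$, be the discretization into $q$ equal arcs, applied sitewise to configurations. For $\sigma'\in\{0,\dots,q-1\}^G$ the constrained first-layer specification is $$\gamma^{\sigma'}_\Lambda(B\mid\eta)=\frac{\int \lambda^{\otimes\Lambda}(d\sigma_\Lambda)\,1_{T(\sigma_\Lambda)=\sigma'_\Lambda}\,1_B(\sigma_\Lambda\eta_{\Lambda^c})\,e^{-H_\Lambda(\sigma_\Lambda\eta_{\Lambda^c})}}{\int \lambda^{\otimes\Lambda}(d\sigma_\Lambda)\,1_{T(\sigma_\Lambda)=\sigma'_\Lambda}\,e^{-H_\Lambda(\sigma_\Lambda\eta_{\Lambda^c})}},\qquad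 \Lambda\subset G\text{ finite}.$$ Let $\alpha_2>0$ and suppose that the interaction decays exponentially with rate $\alpha_2$, $$\sum_{A\ni 0}\Big(\sum_{j\in A}e^{\alpha_2|j|}\Big)\|\Phi_A\|_\infty<\infty$$ (this holds for every $\alpha_2>0$ if $\Phi$ has finite range, in particular for the nearest-neighbour rotator model at any inverse temperature). Then there is $q_0=q_0(\Phi,\alpha_2)$ such that for every $q\ge q_0$ the following holds. 1. For every $\sigma'\in\{0,\dots,q-1\}^G$ there is exactly one Gibbs measure $\mu_G[\sigma']$ for $\gamma^{\sigma'}$, i.e. exactly one probability measure on $(S^1)^G$ that is carried by $\{\sigma: T(\sigma)=\sigma'\}$ and satisfies the DLR equations $\int\mu(d\eta)\,\gamma^{\sigma'}_\Lambda(B\mid\eta)=\mu(B)$ for all finite $\Lambda$ and measurable $B$. 2. For every $\tau\in[0,2\pi)$ the update kernel $M_\tau$, where $M_\tau(\sigma',\cdot)$ is the law of $T(\sigma+\tau)$ for $\sigma$ distributed according to $\mu_G[\sigma']$, is uniformly spatially mixing in the future with exponent $\alpha_2$: there is a constant $K_2>0$ such that for every starting configuration $\sigma'$, all finite $\Lambda\subset\Delta\subset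 G$, every event $A$ in the $\sigma$-algebra generated by the coordinates in $\Lambda$ and every event $B$ in the $\sigma$-algebra generated by the coordinates in $G\setminus\Delta$ with $M_\tau(\sigma',B)>0$, $$|M_\tau(\sigma',A\mid B)-M_\tau(\sigma',A)|\le K_2\sum_{i\in\Lambda,\;j\in G\setminus\Delta}e^{-\alpha_2|i-j|}.$$ -/

import Mathlib

open MeasureTheory ProbabilityTheory Set
open scoped ENNReal

namespace RotMix

/-- The lattice `ℤ^d`. -/
abbrev Site (d : ℕ) : Type := Fin d → ℤ

/-- The distance `|i - j|` on the lattice (graph distance, i.e. the `ℓ¹` distance). -/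
def latDist {d : ℕ} (i j : Site d) : ℝ := ∑ k, |((i k - j k : ℤ) : ℝ)|

/-- The circle `S¹ = ℝ / 2πℤ`. Its `volume` is Lebesgue measure of total mass `2π`. -/
abbrev Circ : Type := AddCircle (2 * Real.pi)

instance factTwoPiPos : Fact (0 < 2 * Real.pi) := ⟨Real.two_pi_pos⟩

/-- Continuous-spin configurations. -/
abbrev CConf (d : ℕ) : Type := Site d → Circ

/-- Discrete-spin configurations. -/
abbrev DConf (d q : ℕ) : Type := Site d → Fin q

/-- The representative in `[0, 2π)` of a point of the circle. -/
noncomputable def rep (x : Circ) : ℝ := (AddCircle.equivIco (2 * Real.pi) 0 x : ℝ)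

theorem rep_nonneg (x : Circ) : 0 ≤ rep x :=
  (AddCircle.equivIco (2 * Real.pi) 0 x).2.1

theorem rep_lt (x : Circ) : rep x < 2 * Real.pi := by
  simpa [rep] using (AddCircle.equivIco (2 * Real.pi) 0 x).2.2

theorem floor_rep_lt (q : ℕ) [NeZero q] (x : Circ) :
    ⌊(q : ℝ) * rep x / (2 * Real.pi)⌋₊ < q := by
  have hq : (0 : ℝ) < q := by exact_mod_cast Nat.pos_of_ne_zero (NeZero.ne q)
  have hπ := Real.two_pi_pos
  rw [Nat.floor_lt (div_nonneg (mul_nonneg hq.le (rep_nonneg x)) hπ.le), div_lt_iff₀ hπ]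
  exact mul_lt_mul_of_pos_left (rep_lt x) hq

/-- The coarse-graining `T` of the circle into `q` equal half-open arcs, labelled by
`0, …, q - 1`: the arc with label `k` is `[2πk/q, 2π(k+1)/q)`. -/
noncomputable def coarse (q : ℕ) [NeZero q] (x : Circ) : Fin q :=
  ⟨⌊(q : ℝ) * rep x / (2 * Real.pi)⌋₊, floor_rep_lt q x⟩

theorem coarse_eq_iff (q : ℕ) [NeZero q] (x : Circ) (k : Fin q) :
    coarse q x = k ↔
      2 * Real.pi * (k : ℕ) / q ≤ rep x ∧ rep x < 2 * Real.pi * ((k : ℕ) + 1) / q := by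
  have hq : (0 : ℝ) < q := by exact_mod_cast Nat.pos_of_ne_zero (NeZero.ne q)
  have hπ := Real.two_pi_pos
  rw [coarse, Fin.ext_iff]
  simp only
  rw [Nat.floor_eq_iff (div_nonneg (mul_nonneg hq.le (rep_nonneg x)) hπ.le),
    le_div_iff₀ hπ, div_lt_iff₀ hπ, div_le_iff₀ hq, lt_div_iff₀ hq]
  constructor <;> rintro ⟨h1, h2⟩ <;> constructor <;> linarith

theorem measurable_coarse (q : ℕ) [NeZero q] : Measurable (coarse q) := by
  have hrep : Measurable rep :=
    measurable_subtype_coe.comp (AddCircle.measurableEquivIco (2 * Real.pi) 0).measurable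
  have h : Measurable fun x : Circ => ⌊(q : ℝ) * rep x / (2 * Real.pi)⌋₊ :=
    Nat.measurable_floor.comp ((hrep.const_mul _).div_const _)
  refine measurable_to_countable' fun k => ?_
  have : coarse q ⁻¹' {k} = (fun x : Circ => ⌊(q : ℝ) * rep x / (2 * Real.pi)⌋₊) ⁻¹' {(k : ℕ)} := by
    ext x
    simp [coarse, Fin.ext_iff]
  rw [this]
  exact h (measurableSet_singleton _)

/-- The uniform norm of a function of the configuration. -/
noncomputable def supNorm {d : ℕ} (f : CConf d → ℝ) : ℝ := ⨆ σ, |f σ|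

/-- An absolutely summable, continuous potential `Φ = (Φ_A)` on `(S¹)^(ℤ^d)`, indexed by the
finite subsets of `ℤ^d`, which is invariant under lattice translations and under the joint
rotation of all spins. -/
structure Potential (d : ℕ) where
  /-- the interaction terms `Φ_A` -/
  toFun : Finset (Site d) → CConf d → ℝ
  /-- `Φ_A` is a function of the spins in `A` -/
  dependsOn : ∀ A, DependsOn (toFun A) (A : Set (Site d))
  continuous : ∀ A, Continuous (toFun A)
  translation : ∀ (A : Finset (Site d)) (v : Site d) (σ : CConf d),
    toFun (A.image fun i => i + v) σ = toFun A fun i => σ (i + v)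
  rotation : ∀ (A : Finset (Site d)) (t : Circ) (σ : CConf d),
    (toFun A fun i => σ i + t) = toFun A σ
  absSummable : Summable fun A : {A : Finset (Site d) // (0 : Site d) ∈ A} => supNorm (toFun A.1)

/-- The interaction decays exponentially with rate `α`:
`∑_{A ∋ 0} (∑_{j ∈ A} e^{α|j|}) ‖Φ_A‖ < ∞`. -/
def Potential.ExpSummable {d : ℕ} (Φ : Potential d) (α : ℝ) : Prop :=
  Summable fun A : {A : Finset (Site d) // (0 : Site d) ∈ A} =>
    (∑ j ∈ A.1, Real.exp (α * latDist 0 j)) * supNorm (Φ.toFun A.1)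

/-- The Hamiltonian `H_Λ = ∑_{A ∩ Λ ≠ ∅} Φ_A`. -/
noncomputable def Potential.ham {d : ℕ} (Φ : Potential d) (Λ : Finset (Site d)) (σ : CConf d) : ℝ :=
  ∑' A : {A : Finset (Site d) // (A ∩ Λ).Nonempty}, Φ.toFun A.1 σ

/-- The configuration `ζ_Λ η_{Λᶜ}`. -/
def glue {d : ℕ} (Λ : Finset (Site d)) (ζ : Λ → Circ) (η : CConf d) : CConf d :=
  fun i => if h : i ∈ Λ then ζ ⟨i, h⟩ else η i

/-- The measure `B ↦ ∫ λ^Λ(dζ) 1_{T(ζ) = σ'_Λ} 1_B(ζ_Λ η_{Λᶜ}) exp(-H_Λ(ζ_Λ η_{Λᶜ}))`. -/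
noncomputable def constrainedWeight {d : ℕ} (Φ : Potential d) (q : ℕ) [NeZero q] (σ' : DConf d q)
    (Λ : Finset (Site d)) (η : CConf d) (B : Set (CConf d)) : ℝ≥0∞ :=
  ∫⁻ ζ in {ζ : Λ → Circ | (∀ i, coarse q (ζ i) = σ' i.1) ∧ glue Λ ζ η ∈ B},
    ENNReal.ofReal (Real.exp (-Φ.ham Λ (glue Λ ζ η)))
      ∂(Measure.pi fun _ : Λ => (volume : Measure Circ))

/-- The constrained first-layer specification `γ^{σ'}_Λ(B | η)`: the Gibbsian specification of `Φ`
in which every spin is constrained to the arc prescribed by the discrete configuration `σ'`. -/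
noncomputable def constrainedSpec {d : ℕ} (Φ : Potential d) (q : ℕ) [NeZero q] (σ' : DConf d q)
    (Λ : Finset (Site d)) (η : CConf d) (B : Set (CConf d)) : ℝ≥0∞ :=
  constrainedWeight Φ q σ' Λ η B / constrainedWeight Φ q σ' Λ η univ

/-- `μ` is a Gibbs measure for the constrained specification `γ^{σ'}`: a probability measure
carried by `{T(σ) = σ'}` that satisfies the DLR equations. -/
structure IsConstrainedGibbs {d : ℕ} (Φ : Potential d) (q : ℕ) [NeZero q] (σ' : DConf d q)
    (μ : Measure (CConf d)) : Prop where
  isProbabilityMeasure : IsProbabilityMeasure μ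
  constrained : ∀ᵐ σ ∂μ, ∀ i, coarse q (σ i) = σ' i
  dlr : ∀ (Λ : Finset (Site d)) (B : Set (CConf d)), MeasurableSet B →
    ∫⁻ η, constrainedSpec Φ q σ' Λ η B ∂μ = μ B

/-- The measure `μ_G[σ']`: the Gibbs measure for the constrained specification `γ^{σ'}`.
(An arbitrary measure if there is none.) -/
noncomputable def constrainedGibbs {d : ℕ} (Φ : Potential d) (q : ℕ) [NeZero q] (σ' : DConf d q) :
    Measure (CConf d) :=
  Classical.epsilon (IsConstrainedGibbs Φ q σ')

/-- The update kernel `M_τ(σ', ·)`: the law of `T(σ + τ)` when `σ` has law `μ_G[σ']`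
(sample, rotate all spins by `τ`, project). -/
noncomputable def updateKernel {d : ℕ} (Φ : Potential d) (q : ℕ) [NeZero q] (τ : ℝ)
    (σ' : DConf d q) : Measure (DConf d q) :=
  (constrainedGibbs Φ q σ').map fun σ i => coarse q (σ i + (τ : Circ))

/-- `M` is uniformly spatially mixing in the future with exponent `α`: for a constant `K > 0`,
`|M_σ(A | B) - M_σ(A)| ≤ K ∑_{i ∈ Λ, j ∉ Δ} e^{-α|i-j|}` for every starting configuration `σ`, all
finite volumes `Λ ⊆ Δ`, every event `A` in `Λ` and every event `B` outside `Δ` that has positive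
probability. -/
def UniformlyMixingInFuture {d q : ℕ} (M : DConf d q → Measure (DConf d q)) (α : ℝ) : Prop :=
  ∃ K : ℝ, 0 < K ∧ ∀ (σ : DConf d q) (Λ Δ : Finset (Site d)), Λ ⊆ Δ →
    ∀ A B : Set (DConf d q),
      MeasurableSet[cylinderEvents (Λ : Set (Site d))] A →
      MeasurableSet[cylinderEvents ((Δ : Set (Site d))ᶜ)] B →
      M σ B ≠ 0 →
      |((M σ)[|B]).real A - (M σ).real A| ≤
        K * ∑ i ∈ Λ, ∑' j : {j : Site d // j ∉ Δ}, Real.exp (-α * latDist i j.1)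

end RotMix

namespace RotMix

open Filter Topology Function

/-! ### The lattice distance -/

/-! When every spin is confined to an arc of length 2π/q, each `Φ_A` can vary only by its
oscillation at scale 2π/q, which tends to 0 as q grows. Exponential summability dominates the
weighted sum of these oscillations, so for large q the constrained system is in the Dobrushin
regime, uniformly in σ', with an influence matrix E that is small even when weighted by exp(α₂|i-j|)
(`tendsto_oscSum`, `abs_ham_sub_le`).

The core is a comparison of two measures μ, ν carried by the constrained set and satisfying the
single-site DLR equations in Δ. A vector a is an estimate if |μ(f) - ν(f)| ≤ ∑ a_j b_j whenever f is
bounded and measurable with summable oscillations b. Averaging f over the spin at i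
(`HasOsc.integral_gibbsMeasure`) allows a_i to be replaced by 4 ∑_j E_ij a_j (`update_isEstimate`).
Iterating from a = 1, the estimates decrease to min(1, w) for any nonnegative weight w with w ≥ 1
off Δ and w_j ≤ exp(α₂|i-j|) w_i (`isEstimate_min`).

With Δ the whole lattice and w = 0 this is uniqueness. Conditioning on an event outside Δ preserves
the DLR equations inside Δ (`IsInvariantAt.cond`), and w_i = ∑_{j ∉ Δ} exp(-α₂|i-j|) is admissible;
this is mixing, with constant 1. Existence is compactness together with the Feller property. -/

theorem latDist_nonneg {d : ℕ} (i j : Site d) : 0 ≤ latDist i j :=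
  Finset.sum_nonneg fun _ _ => abs_nonneg _

@[simp] theorem latDist_self {d : ℕ} (i : Site d) : latDist i i = 0 := by simp [latDist]

theorem latDist_triangle {d : ℕ} (i j k : Site d) : latDist i k ≤ latDist i j + latDist j k := by
  rw [latDist, latDist, latDist, ← Finset.sum_add_distrib]
  refine Finset.sum_le_sum fun l _ => ?_
  have : ((i l - k l : ℤ) : ℝ) = ((i l - j l : ℤ) : ℝ) + ((j l - k l : ℤ) : ℝ) := by
    push_cast; ring
  rw [this]
  exact abs_add_le _ _

theorem latDist_zero_add {d : ℕ} (v j : Site d) : latDist v (j + v) = latDist 0 j := by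
  simp [latDist]

theorem summable_exp_abs_int {α : ℝ} (hα : 0 < α) :
    Summable fun n : ℤ => Real.exp (-α * |(n : ℝ)|) := by
  have h : Summable fun n : ℕ => Real.exp (-α * |(n : ℝ)|) := by
    simp_rw [Nat.abs_cast]
    simpa [mul_comm] using Real.summable_exp_nat_mul_iff.2 (neg_lt_zero.2 hα)
  refine Summable.of_nat_of_neg (by simpa using h) (by simpa using h)

/-- The ℓ¹ distance makes the weight a product over coordinates, so induction on d reduces to
geometric series. -/
theorem summable_exp_latDist_zero {α : ℝ} (hα : 0 < α) (d : ℕ) :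
    Summable fun j : Site d => Real.exp (-α * latDist 0 j) := by
  induction d with
  | zero => exact Summable.of_finite
  | succ d ih =>
    rw [← (Fin.consEquiv fun _ : Fin (d + 1) => ℤ).summable_iff]
    refine ((summable_exp_abs_int hα).mul_of_nonneg ih (fun _ => (Real.exp_pos _).le)
      (fun _ => (Real.exp_pos _).le)).congr fun p => ?_
    simp only [Function.comp_apply, latDist, Fin.sum_univ_succ, Fin.consEquiv_apply, Fin.cons_zero,
      Fin.cons_succ, ← Real.exp_add, mul_add]
    simp

theorem summable_exp_latDist {α : ℝ} (hα : 0 < α) {d : ℕ} (i : Site d) :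
    Summable fun j : Site d => Real.exp (-α * latDist i j) := by
  rw [← (Equiv.addRight i).summable_iff]
  exact (summable_exp_latDist_zero hα d).congr fun j => by simp [latDist_zero_add]

/-! ### Arcs -/

/-- The representatives lie in one interval of length 2π/q, and passing to the quotient does not
increase the norm. -/
theorem dist_le_of_coarse_eq {q : ℕ} [NeZero q] {x y : Circ} (h : coarse q x = coarse q y) :
    dist x y ≤ 2 * Real.pi / q := by
  have hq : (0 : ℝ) < q := by exact_mod_cast Nat.pos_of_ne_zero (NeZero.ne q)
  obtain ⟨h1, h2⟩ := (coarse_eq_iff q x _).1 rfl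
  obtain ⟨h3, h4⟩ := (coarse_eq_iff q y _).1 h.symm
  have hx : ((rep x : ℝ) : Circ) = x := AddCircle.coe_equivIco
  have hy : ((rep y : ℝ) : Circ) = y := AddCircle.coe_equivIco
  have h5 : 2 * Real.pi * (((coarse q x : Fin q) : ℕ) + 1) / q
      = 2 * Real.pi * ((coarse q x : Fin q) : ℕ) / q + 2 * Real.pi / q := by ring
  rw [h5] at h2 h4
  calc dist x y = ‖((rep x - rep y : ℝ) : Circ)‖ := by
        rw [dist_eq_norm, AddCircle.coe_sub, hx, hy]
    _ ≤ |rep x - rep y| := by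
        exact QuotientAddGroup.norm_mk_le_norm (S := AddSubgroup.zmultiples (2 * Real.pi))
    _ ≤ 2 * Real.pi / q := by rw [abs_le]; constructor <;> linarith

/-! ### Norms and oscillations of the interaction terms -/

namespace Potential

variable {d : ℕ} (Φ : Potential d)

theorem abs_le_supNorm (A : Finset (Site d)) (σ : CConf d) :
    |Φ.toFun A σ| ≤ supNorm (Φ.toFun A) :=
  le_ciSup (f := fun σ => |Φ.toFun A σ|) (isCompact_range (Φ.continuous A).abs).bddAbove σ

theorem supNorm_nonneg (A : Finset (Site d)) : 0 ≤ supNorm (Φ.toFun A) :=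
  Real.iSup_nonneg fun _ => abs_nonneg _

/-- The oscillation of `Φ_A` between configurations at sitewise distance at most `δ`. -/
noncomputable def osc (δ : ℝ) (A : Finset (Site d)) : ℝ :=
  ⨆ p : {p : CConf d × CConf d // ∀ i, dist (p.1 i) (p.2 i) ≤ δ},
    |Φ.toFun A p.1.1 - Φ.toFun A p.1.2|

theorem abs_sub_le_two_supNorm (A : Finset (Site d)) (x y : CConf d) :
    |Φ.toFun A x - Φ.toFun A y| ≤ 2 * supNorm (Φ.toFun A) := by
  have h1 := Φ.abs_le_supNorm A x
  have h2 := Φ.abs_le_supNorm A y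
  have := abs_sub (Φ.toFun A x) (Φ.toFun A y)
  linarith

theorem osc_nonneg (δ : ℝ) (A : Finset (Site d)) : 0 ≤ Φ.osc δ A :=
  Real.iSup_nonneg fun _ => abs_nonneg _

theorem osc_le_two_supNorm (δ : ℝ) (A : Finset (Site d)) :
    Φ.osc δ A ≤ 2 * supNorm (Φ.toFun A) :=
  Real.iSup_le (fun _ => Φ.abs_sub_le_two_supNorm A _ _)
    (mul_nonneg zero_le_two (Φ.supNorm_nonneg A))

theorem abs_sub_le_osc {δ : ℝ} (A : Finset (Site d)) {x y : CConf d}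
    (h : ∀ i, dist (x i) (y i) ≤ δ) : |Φ.toFun A x - Φ.toFun A y| ≤ Φ.osc δ A :=
  le_ciSup (f := fun p : {p : CConf d × CConf d // ∀ i, dist (p.1 i) (p.2 i) ≤ δ} =>
    |Φ.toFun A p.1.1 - Φ.toFun A p.1.2|)
    ⟨2 * supNorm (Φ.toFun A), by rintro _ ⟨p, rfl⟩; exact Φ.abs_sub_le_two_supNorm A _ _⟩
    ⟨(x, y), h⟩

theorem osc_image (δ : ℝ) (A : Finset (Site d)) (v : Site d) :
    Φ.osc δ (A.image fun i => i + v) = Φ.osc δ A := by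
  refine le_antisymm (Real.iSup_le ?_ (Φ.osc_nonneg _ _)) (Real.iSup_le ?_ (Φ.osc_nonneg _ _))
  · rintro ⟨⟨x, y⟩, h⟩
    simp only [Φ.translation]
    exact Φ.abs_sub_le_osc A fun i => h (i + v)
  · rintro ⟨⟨x, y⟩, h⟩
    have key : ∀ z : CConf d,
        Φ.toFun A z = Φ.toFun (A.image fun i => i + v) fun i => z (i - v) := fun z => by
      rw [Φ.translation]; simp only [add_sub_cancel_right]
    simp only [key]
    exact Φ.abs_sub_le_osc _ fun i => h (i - v)

theorem supNorm_image (A : Finset (Site d)) (v : Site d) :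
    supNorm (Φ.toFun (A.image fun i => i + v)) = supNorm (Φ.toFun A) := by
  refine le_antisymm (Real.iSup_le ?_ (Φ.supNorm_nonneg _)) (Real.iSup_le ?_ (Φ.supNorm_nonneg _))
  · intro x
    rw [Φ.translation]
    exact Φ.abs_le_supNorm A _
  · intro x
    have key : Φ.toFun A x = Φ.toFun (A.image fun i => i + v) fun i => x (i - v) := by
      rw [Φ.translation]; simp only [add_sub_cancel_right]
    rw [key]
    exact Φ.abs_le_supNorm _ _

/-- Compactness gives uniform continuity, and an entourage of the product constrains only finitely
many coordinates; a sitewise bound below finitely many radii therefore suffices. -/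
theorem tendsto_osc (A : Finset (Site d)) :
    Tendsto (fun q : ℕ => Φ.osc (2 * Real.pi / q) A) atTop (𝓝 0) := by
  have hδ : Tendsto (fun q : ℕ => 2 * Real.pi / (q : ℝ)) atTop (𝓝 0) :=
    tendsto_const_nhds.div_atTop tendsto_natCast_atTop_atTop
  refine Metric.tendsto_atTop.2 fun ε hε => ?_
  have huc := CompactSpace.uniformContinuous_of_continuous (Φ.continuous A)
  have hU := huc (Metric.dist_mem_uniformity (half_pos hε))
  rw [mem_map, Pi.uniformity, Filter.mem_iInf] at hU
  obtain ⟨I, hI, V, hV, hUV⟩ := hU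
  have hV' : ∀ i : I, ∃ r > 0, ∀ x y : CConf d, dist (x i) (y i) < r → (x, y) ∈ V i := by
    intro i
    obtain ⟨W, hW, hWV⟩ := hV i
    obtain ⟨r, hr, hrW⟩ := Metric.mem_uniformity_dist.1 hW
    exact ⟨r, hr, fun x y h => hWV (hrW h)⟩
  choose r hr hrV using hV'
  have := hI.to_subtype
  have hev : ∀ᶠ q : ℕ in atTop, ∀ i : I, 2 * Real.pi / (q : ℝ) < r i :=
    eventually_all.2 fun i => hδ.eventually_lt_const (hr i)
  obtain ⟨N, hN⟩ := eventually_atTop.1 hev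
  refine ⟨N, fun q hq => ?_⟩
  rw [Real.dist_eq, sub_zero, abs_of_nonneg (Φ.osc_nonneg _ _)]
  refine lt_of_le_of_lt (Real.iSup_le ?_ (half_pos hε).le) (half_lt_self hε)
  rintro ⟨⟨x, y⟩, h⟩
  have hmem : (x, y) ∈ ⋂ i, V i :=
    mem_iInter.2 fun i => hrV i x y ((h i).trans_lt (hN q hq i))
  rw [← hUV] at hmem
  exact le_of_lt (by simpa [Real.dist_eq] using hmem)

/-- Translation by `v`, as a bijection from the finite sets containing `0` to those containing
`v`. -/
def shiftEquiv (v : Site d) :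
    {A : Finset (Site d) // (0 : Site d) ∈ A} ≃ {A : Finset (Site d) // v ∈ A} :=
  (Equiv.finsetCongr (Equiv.addRight v)).subtypeEquiv fun A => by simp

theorem shiftEquiv_coe (v : Site d) (A : {A : Finset (Site d) // (0 : Site d) ∈ A}) :
    (shiftEquiv v A : Finset (Site d)) = A.1.image fun i => i + v := by
  simp [shiftEquiv, Finset.map_eq_image]

theorem sum_exp_image (α : ℝ) (v : Site d) (A : Finset (Site d)) :
    ∑ j ∈ A.image (fun i => i + v), Real.exp (α * latDist v j)
      = ∑ j ∈ A, Real.exp (α * latDist 0 j) := by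
  rw [Finset.sum_image fun a _ b _ h => add_right_cancel h]
  exact Finset.sum_congr rfl fun j _ => by rw [latDist_zero_add]

theorem summable_supNorm (v : Site d) :
    Summable fun A : {A : Finset (Site d) // v ∈ A} => supNorm (Φ.toFun A.1) := by
  rw [← (shiftEquiv v).summable_iff]
  exact Φ.absSummable.congr fun A => by
    simp only [Function.comp_apply, shiftEquiv_coe, supNorm_image]

/-- The exponentially weighted total oscillation of the terms that involve the origin. -/
noncomputable def oscSum (α δ : ℝ) : ℝ :=
  ∑' A : {A : Finset (Site d) // (0 : Site d) ∈ A},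
    (∑ j ∈ A.1, Real.exp (α * latDist 0 j)) * Φ.osc δ A.1

variable {Φ}

theorem ExpSummable.summable_osc_zero {α : ℝ} (h : Φ.ExpSummable α) (δ : ℝ) :
    Summable fun A : {A : Finset (Site d) // (0 : Site d) ∈ A} =>
      (∑ j ∈ A.1, Real.exp (α * latDist 0 j)) * Φ.osc δ A.1 := by
  refine Summable.of_nonneg_of_le (fun A => ?_) (fun A => ?_) (h.mul_left 2)
  · exact mul_nonneg (Finset.sum_nonneg fun _ _ => (Real.exp_pos _).le) (Φ.osc_nonneg _ _)
  · have h1 := Φ.osc_le_two_supNorm δ A.1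
    have h2 : 0 ≤ ∑ j ∈ A.1, Real.exp (α * latDist 0 j) :=
      Finset.sum_nonneg fun _ _ => (Real.exp_pos _).le
    nlinarith [mul_le_mul_of_nonneg_left h1 h2]

/-- Dominated convergence, with majorant twice the summand of `ExpSummable`. This is the source of
q₀. -/
theorem ExpSummable.tendsto_oscSum {α : ℝ} (h : Φ.ExpSummable α) :
    Tendsto (fun q : ℕ => Φ.oscSum α (2 * Real.pi / q)) atTop (𝓝 0) := by
  have h0 : (0 : ℝ) = ∑' _ : {A : Finset (Site d) // (0 : Site d) ∈ A}, (0 : ℝ) := by simp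
  rw [h0]
  refine tendsto_tsum_of_dominated_convergence (h.mul_left 2) (fun A => ?_)
    (Eventually.of_forall fun q A => ?_)
  · simpa using (Φ.tendsto_osc A.1).const_mul (∑ j ∈ A.1, Real.exp (α * latDist 0 j))
  · have h1 := Φ.osc_le_two_supNorm (2 * Real.pi / q) A.1
    have h2 : 0 ≤ ∑ j ∈ A.1, Real.exp (α * latDist 0 j) :=
      Finset.sum_nonneg fun _ _ => (Real.exp_pos _).le
    rw [Real.norm_of_nonneg (mul_nonneg h2 (Φ.osc_nonneg _ _))]
    nlinarith [mul_le_mul_of_nonneg_left h1 h2]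

/-- Translation invariance makes the sum the same at every site, so the smallness obtained at the
origin is uniform. -/
theorem ExpSummable.hasSum_osc {α : ℝ} (h : Φ.ExpSummable α) (δ : ℝ) (v : Site d) :
    HasSum (fun A : {A : Finset (Site d) // v ∈ A} =>
      (∑ j ∈ A.1, Real.exp (α * latDist v j)) * Φ.osc δ A.1) (Φ.oscSum α δ) := by
  rw [← (shiftEquiv v).hasSum_iff]
  have h1 := (h.summable_osc_zero δ).hasSum
  rw [oscSum]
  convert h1 using 2 with A
  simp only [Function.comp_apply, shiftEquiv_coe, sum_exp_image, osc_image]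

/-! ### Influence coefficients and their weighted row sums -/

variable (Φ)

/-- The influence of the spin at `j` on the single-site energy at `i`. -/
noncomputable def infl (δ : ℝ) (i j : Site d) : ℝ :=
  ∑' A : {A : Finset (Site d) // i ∈ A}, if j ∈ A.1 then Φ.osc δ A.1 else 0

theorem infl_nonneg (δ : ℝ) (i j : Site d) : 0 ≤ Φ.infl δ i j :=
  tsum_nonneg fun A => by
    split_ifs
    exacts [Φ.osc_nonneg _ _, le_rfl]

variable {Φ}

/-- Tonelli for the sums over A and over j ∈ A. The weight g is kept general: it is used with the
exponential weight and with the indicator of a disagreement set. -/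
theorem ExpSummable.summable_mul_infl {α : ℝ} (h : Φ.ExpSummable α) (δ : ℝ) (i : Site d)
    {g : Site d → ℝ} (hg : ∀ j, 0 ≤ g j) (hgα : ∀ j, g j ≤ Real.exp (α * latDist i j)) :
    (Summable fun A : {A : Finset (Site d) // i ∈ A} => (∑ j ∈ A.1, g j) * Φ.osc δ A.1) ∧
    (Summable fun j => g j * Φ.infl δ i j) ∧
    ∑' j, g j * Φ.infl δ i j =
      ∑' A : {A : Finset (Site d) // i ∈ A}, (∑ j ∈ A.1, g j) * Φ.osc δ A.1 := by
  set F : {A : Finset (Site d) // i ∈ A} × Site d → ℝ :=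
    fun p => if p.2 ∈ p.1.1 then g p.2 * Φ.osc δ p.1.1 else 0 with hF
  have hF0 : 0 ≤ F := fun p => by
    simp only [hF, Pi.zero_apply]
    split_ifs
    exacts [mul_nonneg (hg _) (Φ.osc_nonneg _ _), le_rfl]
  have hrow : ∀ A : {A : Finset (Site d) // i ∈ A},
      HasSum (fun j => F (A, j)) ((∑ j ∈ A.1, g j) * Φ.osc δ A.1) := fun A => by
    have : (∑ j ∈ A.1, g j) * Φ.osc δ A.1 = ∑ j ∈ A.1, F (A, j) := by
      rw [Finset.sum_mul]
      exact Finset.sum_congr rfl fun j hj => by simp [hF, hj]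
    rw [this]
    exact hasSum_sum_of_ne_finset_zero fun j hj => by simp [hF, hj]
  have hA : Summable fun A : {A : Finset (Site d) // i ∈ A} =>
      (∑ j ∈ A.1, g j) * Φ.osc δ A.1 :=
    Summable.of_nonneg_of_le
      (fun A => mul_nonneg (Finset.sum_nonneg fun j _ => hg j) (Φ.osc_nonneg _ _))
      (fun A => mul_le_mul_of_nonneg_right (Finset.sum_le_sum fun j _ => hgα j)
        (Φ.osc_nonneg _ _)) (h.hasSum_osc δ i).summable
  have hFs : Summable F :=
    (summable_prod_of_nonneg hF0).2 ⟨fun A => (hrow A).summable,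
      hA.congr fun A => (hrow A).tsum_eq.symm⟩
  have hcol : ∀ j, ∑' A, F (A, j) = g j * Φ.infl δ i j := fun j => by
    rw [infl, ← tsum_mul_left]
    exact tsum_congr fun A => by simp [hF, mul_ite]
  refine ⟨hA, (hFs.prod_symm.prod).congr fun j => ?_, ?_⟩
  · exact hcol j
  · simp_rw [← hcol]
    rw [Summable.tsum_comm' (f := fun A j => F (A, j)) hFs (fun A => (hrow A).summable)
      (fun j => (hFs.prod_symm).prod_factor j)]
    exact tsum_congr fun A => (hrow A).tsum_eq

theorem ExpSummable.summable_exp_mul_infl {α : ℝ} (h : Φ.ExpSummable α) (δ : ℝ) (i : Site d) :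
    Summable fun j => Real.exp (α * latDist i j) * Φ.infl δ i j :=
  (h.summable_mul_infl δ i (fun _ => (Real.exp_pos _).le) fun _ => le_rfl).2.1

theorem ExpSummable.tsum_exp_mul_infl {α : ℝ} (h : Φ.ExpSummable α) (δ : ℝ) (i : Site d) :
    ∑' j, Real.exp (α * latDist i j) * Φ.infl δ i j = Φ.oscSum α δ :=
  (h.summable_mul_infl δ i (fun _ => (Real.exp_pos _).le) fun _ => le_rfl).2.2.trans
    (h.hasSum_osc δ i).tsum_eq

end Potential

/-! ### The Hamiltonian -/

namespace Potential

variable {d : ℕ} (Φ : Potential d)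

theorem summable_supNorm_inter (Λ : Finset (Site d)) :
    Summable fun A : {A : Finset (Site d) // (A ∩ Λ).Nonempty} => supNorm (Φ.toFun A.1) := by
  have h : ∀ i ∈ Λ, Summable
      ({A : Finset (Site d) | i ∈ A}.indicator fun A => supNorm (Φ.toFun A)) := fun i _ =>
    summable_subtype_iff_indicator.1 (Φ.summable_supNorm i)
  refine (summable_subtype_iff_indicator (s := {A : Finset (Site d) | (A ∩ Λ).Nonempty})
    (f := fun A => supNorm (Φ.toFun A))).2 ?_
  refine Summable.of_nonneg_of_le
    (fun A => indicator_nonneg (fun A _ => Φ.supNorm_nonneg A) A) (fun A => ?_) (summable_sum h)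
  have h0 : ∀ i ∈ Λ, 0 ≤ ({A : Finset (Site d) | i ∈ A}.indicator
      fun A => supNorm (Φ.toFun A)) A := fun i _ =>
    indicator_nonneg (fun A _ => Φ.supNorm_nonneg A) A
  by_cases hA : (A ∩ Λ).Nonempty
  · obtain ⟨i, hi⟩ := hA
    rw [Finset.mem_inter] at hi
    rw [indicator_of_mem (show A ∈ {A : Finset (Site d) | (A ∩ Λ).Nonempty} from
      ⟨i, Finset.mem_inter.2 hi⟩)]
    refine le_trans ?_ (Finset.single_le_sum h0 hi.2)
    rw [indicator_of_mem (show A ∈ {A : Finset (Site d) | i ∈ A} from hi.1)]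
  · rw [indicator_of_notMem (show A ∉ {A : Finset (Site d) | (A ∩ Λ).Nonempty} from hA)]
    exact Finset.sum_nonneg h0

theorem summable_ham (Λ : Finset (Site d)) (σ : CConf d) :
    Summable fun A : {A : Finset (Site d) // (A ∩ Λ).Nonempty} => Φ.toFun A.1 σ :=
  (Φ.summable_supNorm_inter Λ).of_norm_bounded fun A => Φ.abs_le_supNorm A.1 σ

theorem continuous_ham (Λ : Finset (Site d)) : Continuous (Φ.ham Λ) :=
  continuous_tsum (fun A => Φ.continuous A.1) (Φ.summable_supNorm_inter Λ)
    fun A σ => Φ.abs_le_supNorm A.1 σ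

theorem measurable_ham (Λ : Finset (Site d)) : Measurable (Φ.ham Λ) :=
  (Φ.continuous_ham Λ).measurable

theorem exists_abs_ham_le (Λ : Finset (Site d)) : ∃ M, ∀ σ, |Φ.ham Λ σ| ≤ M :=
  ⟨∑' A : {A : Finset (Site d) // (A ∩ Λ).Nonempty}, supNorm (Φ.toFun A.1), fun σ =>
    tsum_of_norm_bounded (f := fun A : {A : Finset (Site d) // (A ∩ Λ).Nonempty} =>
      Φ.toFun A.1 σ) (Φ.summable_supNorm_inter Λ).hasSum fun A => Φ.abs_le_supNorm A.1 σ⟩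

/-- Terms `Φ_A` with A disjoint from Λ do not see the difference of x and y. Equivalently, H_Δ - H_Λ
does not depend on the spins in Λ, which is what consistency of the kernels needs. -/
theorem ham_sub_ham {Λ Δ : Finset (Site d)} (hΛΔ : Λ ⊆ Δ) {x y : CConf d}
    (hxy : ∀ i ∉ Λ, x i = y i) : Φ.ham Δ x - Φ.ham Δ y = Φ.ham Λ x - Φ.ham Λ y := by
  have h : ∀ Γ : Finset (Site d), Φ.ham Γ x - Φ.ham Γ y =
      ∑' A, {A : Finset (Site d) | (A ∩ Γ).Nonempty}.indicator
        (fun A => Φ.toFun A x - Φ.toFun A y) A := fun Γ => by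
    rw [ham, ham, ← (Φ.summable_ham Γ x).tsum_sub (Φ.summable_ham Γ y), ← tsum_subtype]
    rfl
  rw [h, h]
  refine tsum_congr fun A => ?_
  by_cases hA : (A ∩ Λ).Nonempty
  · have hA' : (A ∩ Δ).Nonempty := hA.mono (Finset.inter_subset_inter_left hΛΔ)
    rw [indicator_of_mem (by exact hA'), indicator_of_mem (by exact hA)]
  · have h0 : Φ.toFun A x - Φ.toFun A y = 0 := sub_eq_zero.2 <| Φ.dependsOn A fun i hi =>
      hxy i fun hΛ => hA ⟨i, Finset.mem_inter.2 ⟨hi, hΛ⟩⟩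
    simp [indicator, h0]

theorem ham_singleton (i : Site d) (σ : CConf d) :
    Φ.ham {i} σ = ∑' A : {A : Finset (Site d) // i ∈ A}, Φ.toFun A.1 σ := by
  have h : ∀ A : Finset (Site d), (A ∩ {i}).Nonempty ↔ i ∈ A := fun A => by
    simp [Finset.Nonempty]
  exact (Equiv.subtypeEquivRight h).tsum_eq
    (fun A : {A : Finset (Site d) // i ∈ A} => Φ.toFun A.1 σ)

/-- The difference vanishes unless x and y disagree somewhere on A, and then the count is at least
1. Counting disagreements makes the bound additive over sites. -/
theorem abs_sub_le_osc_mul_card {δ : ℝ} (A : Finset (Site d)) {x y : CConf d}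
    (h : ∀ i, dist (x i) (y i) ≤ δ) :
    |Φ.toFun A x - Φ.toFun A y| ≤ (∑ j ∈ A, {j | x j ≠ y j}.indicator 1 j) * Φ.osc δ A := by
  have h0 : ∀ j ∈ A, (0 : ℝ) ≤ {j | x j ≠ y j}.indicator 1 j := fun j _ =>
    indicator_nonneg (fun _ _ => zero_le_one) j
  by_cases hA : ∃ j ∈ A, x j ≠ y j
  · obtain ⟨j, hj, hxy⟩ := hA
    have h1 : (1 : ℝ) ≤ ∑ j ∈ A, {j | x j ≠ y j}.indicator 1 j := by
      refine le_trans ?_ (Finset.single_le_sum h0 hj)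
      rw [indicator_of_mem (show j ∈ {j | x j ≠ y j} from hxy)]
      rfl
    exact (Φ.abs_sub_le_osc A h).trans (le_mul_of_one_le_left (Φ.osc_nonneg _ _) h1)
  · push Not at hA
    rw [Φ.dependsOn A fun j hj => hA j hj, sub_self, abs_zero]
    exact mul_nonneg (Finset.sum_nonneg h0) (Φ.osc_nonneg _ _)

variable {Φ}

theorem ExpSummable.abs_ham_sub_le {α : ℝ} (h : Φ.ExpSummable α) (hα : 0 ≤ α) {δ : ℝ}
    (i : Site d) {x y : CConf d} (hxy : ∀ i, dist (x i) (y i) ≤ δ) :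
    |Φ.ham {i} x - Φ.ham {i} y| ≤ ∑' j, {j | x j ≠ y j}.indicator (Φ.infl δ i) j := by
  have h0 : ∀ j, (0 : ℝ) ≤ {j | x j ≠ y j}.indicator 1 j := fun j =>
    indicator_nonneg (fun _ _ => zero_le_one) j
  have h1 : ∀ j, {j | x j ≠ y j}.indicator 1 j ≤ Real.exp (α * latDist i j) := fun j =>
    (indicator_le_self' (f := fun _ => (1 : ℝ)) (fun _ _ => zero_le_one) j).trans
      (Real.one_le_exp (mul_nonneg hα (latDist_nonneg _ _)))
  obtain ⟨hs, -, he⟩ := h.summable_mul_infl δ i h0 h1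
  have hx : ∀ z, Summable fun A : {A : Finset (Site d) // i ∈ A} => Φ.toFun A.1 z := fun z =>
    (Φ.summable_supNorm i).of_norm_bounded fun A => Φ.abs_le_supNorm A.1 z
  rw [ham_singleton, ham_singleton, ← (hx x).tsum_sub (hx y)]
  refine (tsum_of_norm_bounded (f := fun A : {A : Finset (Site d) // i ∈ A} =>
    Φ.toFun A.1 x - Φ.toFun A.1 y) hs.hasSum fun A => Φ.abs_sub_le_osc_mul_card A.1 hxy).trans ?_
  rw [← he]
  refine le_of_eq (tsum_congr fun j => ?_)
  by_cases hj : x j = y j <;> simp [hj]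

end Potential

/-! ### The a priori measures on the arcs -/

/-- Lebesgue measure on the arc with label `k`. -/
noncomputable def arcMeasure (q : ℕ) [NeZero q] (k : Fin q) : Measure Circ :=
  volume.restrict {x | coarse q x = k}

theorem measurableSet_arc (q : ℕ) [NeZero q] (k : Fin q) :
    MeasurableSet {x : Circ | coarse q x = k} :=
  measurable_coarse q (measurableSet_singleton k)

instance (q : ℕ) [NeZero q] (k : Fin q) : IsFiniteMeasure (arcMeasure q k) := by
  unfold arcMeasure; infer_instance

theorem coarse_coe {q : ℕ} [NeZero q] {k : Fin q} {t : ℝ} (h1 : 2 * Real.pi * (k : ℕ) / q < t)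
    (h2 : t < 2 * Real.pi * ((k : ℕ) + 1) / q) : coarse q (t : Circ) = k := by
  have hq : (0 : ℝ) < q := by exact_mod_cast Nat.pos_of_ne_zero (NeZero.ne q)
  have hπ := Real.two_pi_pos
  have hk : ((k : ℕ) : ℝ) + 1 ≤ q := by exact_mod_cast k.2
  have h0 : 0 ≤ t := le_trans (by positivity) h1.le
  have h3 : t < 2 * Real.pi := by
    refine h2.trans_le ?_
    rw [div_le_iff₀ hq]
    exact mul_le_mul_of_nonneg_left hk hπ.le
  have hrep : rep (t : Circ) = t := by
    rw [rep, AddCircle.equivIco_coe_eq ⟨h0, by simpa using h3⟩]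
  rw [coarse_eq_iff, hrep]
  exact ⟨h1.le, h2⟩

instance (q : ℕ) [NeZero q] (k : Fin q) : NeZero (arcMeasure q k) := by
  refine ⟨fun h => ?_⟩
  have hq : (0 : ℝ) < q := by exact_mod_cast Nat.pos_of_ne_zero (NeZero.ne q)
  have hπ := Real.two_pi_pos
  have hk : ((k : ℕ) : ℝ) + 1 ≤ q := by exact_mod_cast k.2
  have h1 := (AddCircle.measurePreserving_mk (2 * Real.pi) 0).measure_preimage
    (measurableSet_arc q k).nullMeasurableSet
  have h2 : volume {x : Circ | coarse q x = k} = 0 := Measure.restrict_eq_zero.1 h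
  rw [h2, Measure.restrict_apply (AddCircle.measurable_mk' (measurableSet_arc q k))] at h1
  -- The open interval avoids the mismatch at the endpoints between the fundamental domain [0, 2π)
  -- of `rep` and the domain (0, 2π] used here for Lebesgue measure.
  have h3 : Ioo (2 * Real.pi * (k : ℕ) / q) (2 * Real.pi * ((k : ℕ) + 1) / q) ⊆
      ((↑) : ℝ → Circ) ⁻¹' {x | coarse q x = k} ∩ Ioc 0 (0 + 2 * Real.pi) := by
    rintro t ⟨ht1, ht2⟩
    refine ⟨coarse_coe ht1 ht2, lt_of_le_of_lt (by positivity) ht1, ?_⟩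
    rw [zero_add]
    refine ht2.le.trans ?_
    rw [div_le_iff₀ hq]
    exact mul_le_mul_of_nonneg_left hk hπ.le
  have h4 := measure_mono_null h3 h1
  rw [Real.volume_Ioo, ENNReal.ofReal_eq_zero] at h4
  have h5 : 2 * Real.pi * ((k : ℕ) + 1) / q - 2 * Real.pi * (k : ℕ) / q = 2 * Real.pi / q := by
    ring
  rw [h5] at h4
  exact absurd h4 (not_le.2 (by positivity))

/-- The configurations in the arcs prescribed by `σ'`. -/
def constrainedSet {d q : ℕ} [NeZero q] (σ' : DConf d q) : Set (CConf d) :=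
  {σ | ∀ i, coarse q (σ i) = σ' i}

/-- The a priori measure on the spins in `Λ`, constrained to the arcs prescribed by `σ'`. -/
noncomputable def arcPi {d q : ℕ} [NeZero q] (σ' : DConf d q) (Λ : Finset (Site d)) :
    Measure (Λ → Circ) :=
  Measure.pi fun i : Λ => arcMeasure q (σ' i)

instance {d q : ℕ} [NeZero q] (σ' : DConf d q) (Λ : Finset (Site d)) :
    IsFiniteMeasure (arcPi σ' Λ) := by
  unfold arcPi; infer_instance

instance {d q : ℕ} [NeZero q] (σ' : DConf d q) (Λ : Finset (Site d)) :
    NeZero (arcPi σ' Λ) := by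
  refine ⟨fun h => ?_⟩
  have h1 : arcPi σ' Λ univ = 0 := by simp [h]
  rw [arcPi, Measure.pi_univ, Finset.prod_eq_zero_iff] at h1
  obtain ⟨i, -, hi⟩ := h1
  exact NeZero.ne _ (Measure.measure_univ_eq_zero.1 hi)

theorem arcPi_eq_restrict {d q : ℕ} [NeZero q] (σ' : DConf d q) (Λ : Finset (Site d)) :
    arcPi σ' Λ = (Measure.pi fun _ : Λ => (volume : Measure Circ)).restrict
      {ζ | ∀ i, coarse q (ζ i) = σ' i.1} := by
  have h : {ζ : Λ → Circ | ∀ i, coarse q (ζ i) = σ' i.1} =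
      univ.pi fun i : Λ => {x : Circ | coarse q x = σ' i.1} := by ext; simp [Set.mem_pi]
  rw [h, Measure.restrict_pi_pi]
  rfl

theorem measurableSet_arcs {d q : ℕ} [NeZero q] (σ' : DConf d q) (Λ : Finset (Site d)) :
    MeasurableSet {ζ : Λ → Circ | ∀ i, coarse q (ζ i) = σ' i.1} := by
  simp only [Set.ofPred_forall]
  exact MeasurableSet.iInter fun i =>
    measurableSet_eq_fun ((measurable_coarse q).comp (measurable_pi_apply i)) measurable_const

theorem ae_arcPi {d q : ℕ} [NeZero q] (σ' : DConf d q) (Λ : Finset (Site d)) :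
    ∀ᵐ ζ ∂arcPi σ' Λ, ∀ i, coarse q (ζ i) = σ' i.1 := by
  rw [arcPi_eq_restrict]
  exact ae_restrict_mem (measurableSet_arcs σ' Λ)

/-! ### Gluing -/

section Glue

variable {d : ℕ} {Λ : Finset (Site d)}

theorem glue_of_mem {ζ : Λ → Circ} {η : CConf d} {i : Site d} (h : i ∈ Λ) :
    glue Λ ζ η i = ζ ⟨i, h⟩ := dif_pos h

theorem glue_of_notMem {ζ : Λ → Circ} {η : CConf d} {i : Site d} (h : i ∉ Λ) :
    glue Λ ζ η i = η i := dif_neg h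

theorem continuous_glue : Continuous fun p : (Λ → Circ) × CConf d => glue Λ p.1 p.2 := by
  refine continuous_pi fun i => ?_
  by_cases h : i ∈ Λ
  · simp only [glue_of_mem h]
    fun_prop
  · simp only [glue_of_notMem h]
    fun_prop

theorem measurable_glue : Measurable fun p : (Λ → Circ) × CConf d => glue Λ p.1 p.2 := by
  refine measurable_pi_lambda _ fun i => ?_
  by_cases h : i ∈ Λ
  · simp only [glue_of_mem h]
    fun_prop
  · simp only [glue_of_notMem h]
    fun_prop

theorem measurable_glue_left (η : CConf d) : Measurable fun ζ : Λ → Circ => glue Λ ζ η :=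
  measurable_glue.comp (measurable_id.prodMk measurable_const)

theorem continuous_glue_right (ζ : Λ → Circ) : Continuous fun η : CConf d => glue Λ ζ η :=
  continuous_glue.comp (continuous_const.prodMk continuous_id)

theorem glue_mem_constrainedSet {q : ℕ} [NeZero q] {σ' : DConf d q} {ζ : Λ → Circ} {η : CConf d}
    (hζ : ∀ i, coarse q (ζ i) = σ' i.1) (hη : η ∈ constrainedSet σ') :
    glue Λ ζ η ∈ constrainedSet σ' := by
  intro i
  by_cases h : i ∈ Λ
  · rw [glue_of_mem h]; exact hζ ⟨i, h⟩
  · rw [glue_of_notMem h]; exact hη i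

end Glue

/-! ### The constrained specification as a family of Markov kernels -/

section Kernel

variable {d q : ℕ} [NeZero q] (Φ : Potential d) (σ' : DConf d q) (Λ : Finset (Site d))

/-- The Boltzmann weight `exp (-H_Λ)`. -/
noncomputable def boltzmann (σ : CConf d) : ℝ≥0∞ := ENNReal.ofReal (Real.exp (-Φ.ham Λ σ))

theorem measurable_boltzmann : Measurable (boltzmann Φ Λ) :=
  (Real.measurable_exp.comp (Φ.measurable_ham Λ).neg).ennreal_ofReal

theorem boltzmann_ne_zero (σ : CConf d) : boltzmann Φ Λ σ ≠ 0 :=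
  (ENNReal.ofReal_pos.2 (Real.exp_pos _)).ne'

/-- Integration over the spins in `Λ` with respect to the constrained a priori measure. -/
noncomputable def arcIntegral (F : CConf d → ℝ≥0∞) : CConf d → ℝ≥0∞ :=
  lmarginal (fun i => arcMeasure q (σ' i)) Λ F

theorem arcIntegral_apply (F : CConf d → ℝ≥0∞) (η : CConf d) :
    arcIntegral σ' Λ F η = ∫⁻ ζ, F (glue Λ ζ η) ∂arcPi σ' Λ := rfl

variable {Λ} in
theorem measurable_arcIntegral {F : CConf d → ℝ≥0∞} (hF : Measurable F) :
    Measurable (arcIntegral σ' Λ F) := hF.lmarginal _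

variable {σ' Λ} in
theorem arcIntegral_mul_left {F G : CConf d → ℝ≥0∞} (hF : Measurable F)
    (hG : ∀ x y, (∀ i ∉ Λ, x i = y i) → G x = G y) (η : CConf d) :
    arcIntegral σ' Λ (fun σ => G σ * F σ) η = G η * arcIntegral σ' Λ F η := by
  rw [arcIntegral_apply, arcIntegral_apply,
    ← lintegral_const_mul (f := fun ζ => F (glue Λ ζ η)) _ (hF.comp (measurable_glue_left η))]
  refine lintegral_congr fun ζ => ?_
  rw [hG (glue Λ ζ η) η fun i hi => glue_of_notMem hi]

/-- The constrained partition function. -/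
noncomputable def partition (η : CConf d) : ℝ≥0∞ := arcIntegral σ' Λ (boltzmann Φ Λ) η

theorem partition_ne_zero (η : CConf d) : partition Φ σ' Λ η ≠ 0 := by
  rw [partition, arcIntegral_apply]
  refine ((lintegral_pos_iff_support
    ((measurable_boltzmann Φ Λ).comp (measurable_glue_left η))).2 ?_).ne'
  have : Function.support (fun ζ => boltzmann Φ Λ (glue Λ ζ η)) = univ := by
    ext ζ; simp [boltzmann_ne_zero]
  refine lt_of_lt_of_eq ?_ (congrArg (arcPi σ' Λ) this.symm)
  exact Measure.measure_univ_pos.2 (NeZero.ne _)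

theorem partition_ne_top (η : CConf d) : partition Φ σ' Λ η ≠ ∞ := by
  obtain ⟨M, hM⟩ := Φ.exists_abs_ham_le Λ
  rw [partition, arcIntegral_apply]
  refine ((lintegral_mono (g := fun _ => ENNReal.ofReal (Real.exp M)) fun ζ => ?_).trans_lt
    ?_).ne
  · exact ENNReal.ofReal_le_ofReal (Real.exp_le_exp.2 ((neg_le_abs _).trans (hM _)))
  · rw [lintegral_const]
    exact ENNReal.mul_lt_top ENNReal.ofReal_lt_top (measure_lt_top _ _)

theorem measurable_partition : Measurable (partition Φ σ' Λ) :=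
  measurable_arcIntegral σ' (measurable_boltzmann Φ Λ)

/-- The measure `γ^{σ'}_Λ(· | η)`. -/
noncomputable def gibbsMeasure (η : CConf d) : Measure (CConf d) :=
  (partition Φ σ' Λ η)⁻¹ •
    ((arcPi σ' Λ).map fun ζ => glue Λ ζ η).withDensity (boltzmann Φ Λ)

theorem lintegral_gibbsMeasure {F : CConf d → ℝ≥0∞} (hF : Measurable F) (η : CConf d) :
    ∫⁻ σ, F σ ∂gibbsMeasure Φ σ' Λ η =
      (partition Φ σ' Λ η)⁻¹ * arcIntegral σ' Λ (fun σ => F σ * boltzmann Φ Λ σ) η := by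
  rw [gibbsMeasure, lintegral_smul_measure,
    lintegral_withDensity_eq_lintegral_mul _ (measurable_boltzmann Φ Λ) hF,
    lintegral_map ((measurable_boltzmann Φ Λ).mul hF) (measurable_glue_left η),
    arcIntegral_apply, smul_eq_mul]
  simp only [Pi.mul_apply, mul_comm]

theorem gibbsMeasure_apply {B : Set (CConf d)} (hB : MeasurableSet B) (η : CConf d) :
    gibbsMeasure Φ σ' Λ η B =
      (partition Φ σ' Λ η)⁻¹ *
        arcIntegral σ' Λ (fun σ => B.indicator 1 σ * boltzmann Φ Λ σ) η := by
  rw [← lintegral_gibbsMeasure Φ σ' Λ (measurable_one.indicator hB), lintegral_indicator_one hB]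

instance (η : CConf d) : IsProbabilityMeasure (gibbsMeasure Φ σ' Λ η) := by
  refine ⟨?_⟩
  rw [gibbsMeasure_apply Φ σ' Λ MeasurableSet.univ]
  simp only [indicator_univ, Pi.one_apply, one_mul]
  exact ENNReal.inv_mul_cancel (partition_ne_zero Φ σ' Λ η) (partition_ne_top Φ σ' Λ η)

theorem constrainedSpec_eq {B : Set (CConf d)} (hB : MeasurableSet B) (η : CConf d) :
    constrainedSpec Φ q σ' Λ η B = gibbsMeasure Φ σ' Λ η B := by
  have key : ∀ {B : Set (CConf d)}, MeasurableSet B → constrainedWeight Φ q σ' Λ η B =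
      arcIntegral σ' Λ (fun σ => B.indicator 1 σ * boltzmann Φ Λ σ) η := fun {B} hB => by
    have hB' : MeasurableSet {ζ : Λ → Circ | glue Λ ζ η ∈ B} := measurable_glue_left η hB
    rw [arcIntegral_apply, arcPi_eq_restrict, constrainedWeight]
    rw [show {ζ : Λ → Circ | (∀ i, coarse q (ζ i) = σ' i.1) ∧ glue Λ ζ η ∈ B} =
      {ζ | glue Λ ζ η ∈ B} ∩ {ζ | ∀ i, coarse q (ζ i) = σ' i.1} from by
        ext; simp [and_comm], ← Measure.restrict_restrict hB', ← lintegral_indicator hB']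
    refine lintegral_congr fun ζ => ?_
    by_cases h : glue Λ ζ η ∈ B <;> simp [Set.indicator, h, boltzmann]
  rw [constrainedSpec, key hB, key MeasurableSet.univ, gibbsMeasure_apply Φ σ' Λ hB,
    ENNReal.div_eq_inv_mul]
  simp only [indicator_univ, Pi.one_apply, one_mul]
  rfl

/-- The Markov kernel `γ^{σ'}_Λ`. -/
noncomputable def gibbsKernel : Kernel (CConf d) (CConf d) where
  toFun := gibbsMeasure Φ σ' Λ
  measurable' := by
    refine Measure.measurable_of_measurable_coe _ fun B hB => ?_
    simp only [gibbsMeasure_apply Φ σ' Λ hB]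
    exact (measurable_partition Φ σ' Λ).inv.mul
      (measurable_arcIntegral σ' ((measurable_one.indicator hB).mul (measurable_boltzmann Φ Λ)))

theorem gibbsKernel_apply (η : CConf d) : gibbsKernel Φ σ' Λ η = gibbsMeasure Φ σ' Λ η := rfl

instance : IsMarkovKernel (gibbsKernel Φ σ' Λ) :=
  ⟨fun η => by rw [gibbsKernel_apply]; infer_instance⟩

theorem isConstrainedGibbs_iff {μ : Measure (CConf d)} :
    IsConstrainedGibbs Φ q σ' μ ↔ IsProbabilityMeasure μ ∧ (∀ᵐ σ ∂μ, σ ∈ constrainedSet σ') ∧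
      ∀ Λ, μ.bind (gibbsKernel Φ σ' Λ) = μ := by
  have key : ∀ Λ (B : Set (CConf d)), MeasurableSet B →
      ∫⁻ η, constrainedSpec Φ q σ' Λ η B ∂μ = μ.bind (gibbsKernel Φ σ' Λ) B := fun Λ B hB => by
    rw [Measure.bind_apply hB (gibbsKernel Φ σ' Λ).aemeasurable]
    exact lintegral_congr fun η => constrainedSpec_eq Φ σ' Λ hB η
  constructor
  · rintro ⟨h1, h2, h3⟩
    exact ⟨h1, h2, fun Λ => Measure.ext fun B hB => (key Λ B hB).symm.trans (h3 Λ B hB)⟩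
  · rintro ⟨h1, h2, h3⟩
    exact ⟨h1, h2, fun Λ B hB => (key Λ B hB).trans (by rw [h3])⟩

/-- The family of kernels `γ^{σ'}_Λ` is consistent. -/
theorem gibbsKernel_comp {Λ Δ : Finset (Site d)} (hΛΔ : Λ ⊆ Δ) :
    (gibbsKernel Φ σ' Λ) ∘ₖ (gibbsKernel Φ σ' Δ) = gibbsKernel Φ σ' Δ := by
  refine Kernel.ext_fun fun η F hF => ?_
  rw [Kernel.lintegral_comp _ _ _ hF]
  simp only [gibbsKernel_apply]
  have hk : Measurable fun η' => ∫⁻ σ, F σ ∂gibbsMeasure Φ σ' Λ η' :=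
    hF.lintegral_kernel (κ := gibbsKernel Φ σ' Λ)
  rw [lintegral_gibbsMeasure Φ σ' Δ hk, lintegral_gibbsMeasure Φ σ' Δ hF]
  congr 1
  -- By Fubini the spins in Λ are integrated first; it then suffices to compare the inner integrals.
  have hunion : ∀ {G : CConf d → ℝ≥0∞}, Measurable G →
      arcIntegral σ' Δ G = arcIntegral σ' (Δ \ Λ) (arcIntegral σ' Λ G) := fun {G} hG => by
    rw [arcIntegral, arcIntegral, arcIntegral, ← lmarginal_union _ _ hG Finset.sdiff_disjoint,
      Finset.sdiff_union_of_subset hΛΔ]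
  rw [hunion (G := fun σ => (∫⁻ σ, F σ ∂gibbsMeasure Φ σ' Λ σ) * boltzmann Φ Δ σ)
    (hk.mul (measurable_boltzmann Φ Δ)), hunion (G := fun σ => F σ * boltzmann Φ Δ σ)
    (hF.mul (measurable_boltzmann Φ Δ))]
  congr 1
  funext σ
  -- The ratio of the two Boltzmann weights is independent of the spins in Λ, as is the inner Gibbs
  -- average. Both leave the integral over Λ, and the remaining partition function cancels the
  -- normalisation.
  set r : CConf d → ℝ≥0∞ := fun σ =>
    ENNReal.ofReal (Real.exp (-(Φ.ham Δ σ - Φ.ham Λ σ))) with hr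
  have hrw : ∀ σ, boltzmann Φ Δ σ = r σ * boltzmann Φ Λ σ := fun σ => by
    rw [hr, boltzmann, boltzmann, ← ENNReal.ofReal_mul (Real.exp_pos _).le, ← Real.exp_add]
    congr 2; ring
  have hrinv : ∀ x y : CConf d, (∀ i ∉ Λ, x i = y i) → r x = r y := fun x y hxy => by
    have := Φ.ham_sub_ham hΛΔ hxy
    simp only [hr]
    congr 3; linarith
  have hkinv : ∀ x y : CConf d, (∀ i ∉ Λ, x i = y i) →
      ∫⁻ σ, F σ ∂gibbsMeasure Φ σ' Λ x = ∫⁻ σ, F σ ∂gibbsMeasure Φ σ' Λ y := fun x y hxy => by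
    rw [lintegral_gibbsMeasure Φ σ' Λ hF, lintegral_gibbsMeasure Φ σ' Λ hF, partition, partition,
      arcIntegral, arcIntegral, lmarginal_congr _ _ hxy,
      lmarginal_congr (x := x) (y := y) _ _ hxy]
  have e1 : arcIntegral σ' Λ
      (fun σ => (∫⁻ σ, F σ ∂gibbsMeasure Φ σ' Λ σ) * boltzmann Φ Δ σ) σ =
      ((∫⁻ σ, F σ ∂gibbsMeasure Φ σ' Λ σ) * r σ) * partition Φ σ' Λ σ := by
    rw [partition, ← arcIntegral_mul_left
      (G := fun σ => (∫⁻ σ, F σ ∂gibbsMeasure Φ σ' Λ σ) * r σ) (measurable_boltzmann Φ Λ)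
      fun x y hxy => by simp only [hkinv x y hxy, hrinv x y hxy]]
    simp only [hrw, mul_assoc]
  have e2 : arcIntegral σ' Λ (fun σ => F σ * boltzmann Φ Δ σ) σ =
      r σ * arcIntegral σ' Λ (fun σ => F σ * boltzmann Φ Λ σ) σ := by
    rw [← arcIntegral_mul_left (F := fun σ => F σ * boltzmann Φ Λ σ)
      (hF.mul (measurable_boltzmann Φ Λ)) hrinv]
    simp only [hrw, mul_left_comm]
  refine e1.trans (Eq.trans ?_ e2.symm)
  rw [lintegral_gibbsMeasure Φ σ' Λ hF]
  have h1 := partition_ne_zero Φ σ' Λ σ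
  have h2 := partition_ne_top Φ σ' Λ σ
  calc _ = (partition Φ σ' Λ σ)⁻¹ * partition Φ σ' Λ σ *
        (r σ * arcIntegral σ' Λ (fun σ => F σ * boltzmann Φ Λ σ) σ) := by ring
    _ = _ := by rw [ENNReal.inv_mul_cancel h1 h2, one_mul]

theorem ae_gibbsMeasure (η : CConf d) :
    ∀ᵐ σ ∂gibbsMeasure Φ σ' Λ η, ∀ i ∈ Λ, coarse q (σ i) = σ' i := by
  refine Measure.ae_smul_measure ?_ _
  refine (withDensity_absolutelyContinuous _ _).ae_le ?_
  have hm : MeasurableSet {σ : CConf d | ∀ i ∈ Λ, coarse q (σ i) = σ' i} := by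
    simp only [Set.ofPred_forall]
    exact MeasurableSet.iInter fun i => MeasurableSet.iInter fun _ =>
      measurableSet_eq_fun ((measurable_coarse q).comp (measurable_pi_apply i)) measurable_const
  refine (ae_map_iff (measurable_glue_left η).aemeasurable hm).2 ?_
  filter_upwards [ae_arcPi σ' Λ] with ζ hζ i hi
  rw [glue_of_mem hi]
  exact hζ ⟨i, hi⟩

theorem integral_gibbsMeasure {f : CConf d → ℝ} (hf : Measurable f) (η : CConf d) :
    ∫ σ, f σ ∂gibbsMeasure Φ σ' Λ η =
      (∫ ζ, f (glue Λ ζ η) * Real.exp (-Φ.ham Λ (glue Λ ζ η)) ∂arcPi σ' Λ) /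
        ∫ ζ, Real.exp (-Φ.ham Λ (glue Λ ζ η)) ∂arcPi σ' Λ := by
  have hm : Measurable fun ζ : Λ → Circ => Real.exp (-Φ.ham Λ (glue Λ ζ η)) :=
    Real.measurable_exp.comp ((Φ.measurable_ham Λ).comp (measurable_glue_left η)).neg
  have hZ : (partition Φ σ' Λ η).toReal =
      ∫ ζ, Real.exp (-Φ.ham Λ (glue Λ ζ η)) ∂arcPi σ' Λ := by
    rw [integral_eq_lintegral_of_nonneg_ae (ae_of_all _ fun _ => (Real.exp_pos _).le)
      hm.aestronglyMeasurable]
    rfl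
  rw [gibbsMeasure, integral_smul_measure, integral_withDensity_eq_integral_toReal_smul
    (measurable_boltzmann Φ Λ) (ae_of_all _ fun _ => ENNReal.ofReal_lt_top), integral_map
    (measurable_glue_left η).aemeasurable
    (by exact ((measurable_boltzmann Φ Λ).ennreal_toReal.smul hf).aestronglyMeasurable),
    ENNReal.toReal_inv, hZ, smul_eq_mul, div_eq_inv_mul]
  simp only [boltzmann, ENNReal.toReal_ofReal (Real.exp_pos _).le, smul_eq_mul, mul_comm]

end Kernel

/-! ### Existence of a constrained Gibbs measure -/

section Existence

variable {d q : ℕ} [NeZero q] (Φ : Potential d) (σ' : DConf d q)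

theorem integral_exp_ham_pos (Λ : Finset (Site d)) (η : CConf d) :
    0 < ∫ ζ, Real.exp (-Φ.ham Λ (glue Λ ζ η)) ∂arcPi σ' Λ := by
  obtain ⟨M, hM⟩ := Φ.exists_abs_ham_le Λ
  have hm : Measurable fun ζ : Λ → Circ => Real.exp (-Φ.ham Λ (glue Λ ζ η)) :=
    Real.measurable_exp.comp ((Φ.measurable_ham Λ).comp (measurable_glue_left η)).neg
  refine integral_exp_pos (Integrable.of_bound hm.aestronglyMeasurable (Real.exp M)
    (ae_of_all _ fun ζ => ?_))
  rw [Real.norm_of_nonneg (Real.exp_pos _).le]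
  exact Real.exp_le_exp.2 ((neg_le_abs _).trans (hM _))

/-- The Feller property of the constrained specification. -/
theorem continuous_integral_gibbsMeasure (Λ : Finset (Site d)) {f : CConf d → ℝ}
    (hf : Continuous f) : Continuous fun η => ∫ σ, f σ ∂gibbsMeasure Φ σ' Λ η := by
  obtain ⟨M, hM⟩ := Φ.exists_abs_ham_le Λ
  have hw : ∀ σ, Real.exp (-Φ.ham Λ σ) ≤ Real.exp M := fun σ =>
    Real.exp_le_exp.2 ((neg_le_abs _).trans (hM _))
  have key : ∀ {g : CConf d → ℝ}, Continuous g → Continuous fun η =>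
      ∫ ζ, g (glue Λ ζ η) * Real.exp (-Φ.ham Λ (glue Λ ζ η)) ∂arcPi σ' Λ := fun {g} hg => by
    obtain ⟨C, hC⟩ := (isCompact_range hg.abs).bddAbove
    have hgm : Continuous fun σ => g σ * Real.exp (-Φ.ham Λ σ) :=
      hg.mul (Real.continuous_exp.comp (Φ.continuous_ham Λ).neg)
    refine continuous_of_dominated (bound := fun _ => C * Real.exp M)
      (fun η => (hgm.measurable.comp (measurable_glue_left η)).aestronglyMeasurable)
      (fun η => ae_of_all _ fun ζ => ?_) (integrable_const _)
      (ae_of_all _ fun ζ => hgm.comp (continuous_glue_right ζ))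
    rw [norm_mul, Real.norm_of_nonneg (Real.exp_pos _).le]
    exact mul_le_mul (hC ⟨_, rfl⟩) (hw _) (Real.exp_pos _).le
      ((abs_nonneg _).trans (hC ⟨glue Λ ζ η, rfl⟩))
  simp only [integral_gibbsMeasure Φ σ' Λ hf.measurable]
  refine (key hf).div ?_ fun η => (integral_exp_ham_pos Φ σ' Λ η).ne'
  simpa using key (continuous_const (y := (1 : ℝ)))

theorem integral_bind_kernel {α : Type*} [MeasurableSpace α] {μ : Measure α} {κ : Kernel α α}
    {f : α → ℝ} (hf : Integrable f (μ.bind κ)) :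
    ∫ x, f x ∂μ.bind κ = ∫ x, ∫ y, f y ∂κ x ∂μ := by
  rw [Measure.comp_eq_comp_const_apply] at hf ⊢
  rw [Kernel.integral_comp hf, Kernel.const_apply]

theorem integrable_of_abs_le {α : Type*} [MeasurableSpace α] {μ : Measure α} [IsFiniteMeasure μ]
    {f : α → ℝ} (hf : Measurable f) {M : ℝ} (hM : ∀ x, |f x| ≤ M) : Integrable f μ :=
  Integrable.of_bound hf.aestronglyMeasurable M (ae_of_all _ hM)

/-- Probability measures on a compact space form a compact space, so the finite-volume measures have
a limit along an ultrafilter finer than `atTop`. For Δ ⊇ Λ they satisfy the DLR equation in Λ by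
consistency, and the Feller property passes it to the limit. The boundary configuration 0 is
arbitrary and need not respect the arcs. -/
theorem exists_isConstrainedGibbs : ∃ μ, IsConstrainedGibbs Φ q σ' μ := by
  let ρ : Finset (Site d) → ProbabilityMeasure (CConf d) := fun Δ =>
    ⟨gibbsMeasure Φ σ' Δ 0, inferInstance⟩
  let U : Ultrafilter (Finset (Site d)) := Ultrafilter.of atTop
  let μ : ProbabilityMeasure (CConf d) := (U.map ρ).lim
  have hμ : Tendsto ρ U (𝓝 μ) := (U.map ρ).le_nhds_lim
  have hint := ProbabilityMeasure.tendsto_iff_forall_integral_tendsto.1 hμ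
  have hdlr : ∀ Λ, (μ : Measure (CConf d)).bind (gibbsKernel Φ σ' Λ) = μ := fun Λ => by
    have : IsFiniteMeasure ((μ : Measure (CConf d)).bind (gibbsKernel Φ σ' Λ)) := inferInstance
    refine ext_of_forall_integral_eq_of_IsFiniteMeasure fun f => ?_
    rw [integral_bind_kernel (integrable_of_abs_le f.continuous.measurable f.norm_coe_le_norm)]
    have hF := continuous_integral_gibbsMeasure Φ σ' Λ f.continuous
    have h1 := hint (BoundedContinuousFunction.mkOfCompact ⟨_, hF⟩)
    refine tendsto_nhds_unique h1 ((hint f).congr' ?_)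
    have hev : ∀ᶠ Δ in (U : Filter (Finset (Site d))), Λ ≤ Δ :=
      Ultrafilter.of_le _ (eventually_ge_atTop Λ)
    filter_upwards [hev] with Δ hΔ
    have h2 : (gibbsMeasure Φ σ' Δ 0).bind (gibbsKernel Φ σ' Λ) = gibbsMeasure Φ σ' Δ 0 := by
      rw [← gibbsKernel_apply, ← Kernel.comp_apply, gibbsKernel_comp Φ σ' hΔ]
    change ∫ σ, f σ ∂gibbsMeasure Φ σ' Δ 0 =
      ∫ η, ∫ σ, f σ ∂gibbsMeasure Φ σ' Λ η ∂gibbsMeasure Φ σ' Δ 0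
    conv_lhs => rw [← h2]
    exact integral_bind_kernel (integrable_of_abs_le f.continuous.measurable f.norm_coe_le_norm)
  refine ⟨μ, (isConstrainedGibbs_iff Φ σ').2 ⟨inferInstance, ae_all_iff.2 fun i => ?_, hdlr⟩⟩
  -- The arcs are not closed, so the constraint is not inherited from the weak limit; it is read off
  -- from the DLR equation at the single site i.
  rw [← hdlr {i}]
  have hm : MeasurableSet {σ : CConf d | coarse q (σ i) = σ' i} :=
    measurableSet_eq_fun ((measurable_coarse q).comp (measurable_pi_apply i)) measurable_const
  refine (Measure.ae_comp_iff hm).2 (ae_of_all _ fun η => ?_)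
  exact (ae_gibbsMeasure Φ σ' {i} η).mono fun σ h => h i (Finset.mem_singleton_self i)

end Existence

/-! ### Comparison of two Boltzmann averages -/

section Average

variable {X : Type*} [MeasurableSpace X] {m : Measure X} [IsFiniteMeasure m]

theorem integrable_exp_neg {u : X → ℝ} (hu : Measurable u) {M : ℝ} (hM : ∀ x, |u x| ≤ M) :
    Integrable (fun x => Real.exp (-u x)) m :=
  integrable_of_abs_le (Real.measurable_exp.comp hu.neg) (M := Real.exp M) fun x => by
    rw [abs_of_pos (Real.exp_pos _)]
    exact Real.exp_le_exp.2 ((neg_le_abs _).trans (hM x))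

variable [NeZero m]

/-- The weight and the normalising integral each contribute one factor exp ε. -/
theorem exp_neg_div_le {u v : X → ℝ} (hu : Measurable u) (hv : Measurable v) {M ε : ℝ}
    (huM : ∀ x, |u x| ≤ M) (hvM : ∀ x, |v x| ≤ M) (huv : ∀ᵐ x ∂m, |u x - v x| ≤ ε) :
    ∀ᵐ x ∂m, Real.exp (-u x) / (∫ y, Real.exp (-u y) ∂m) ≤
      Real.exp (2 * ε) * (Real.exp (-v x) / ∫ y, Real.exp (-v y) ∂m) := by
  have hU := integrable_exp_neg (m := m) hu huM
  have hV := integrable_exp_neg (m := m) hv hvM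
  have hZu := integral_exp_pos hU
  have hZv := integral_exp_pos hV
  have hZ : (∫ y, Real.exp (-v y) ∂m) ≤ Real.exp ε * ∫ y, Real.exp (-u y) ∂m := by
    rw [← integral_const_mul]
    refine integral_mono_ae hV (hU.const_mul _) ?_
    filter_upwards [huv] with x hx
    rw [← Real.exp_add]
    exact Real.exp_le_exp.2 (by linarith [(abs_le.1 hx).2])
  filter_upwards [huv] with x hx
  have h1 : Real.exp (-u x) ≤ Real.exp ε * Real.exp (-v x) := by
    rw [← Real.exp_add]
    exact Real.exp_le_exp.2 (by linarith [(abs_le.1 hx).1])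
  rw [mul_div_assoc', div_le_div_iff₀ hZu hZv, two_mul, Real.exp_add]
  calc Real.exp (-u x) * ∫ y, Real.exp (-v y) ∂m
      ≤ (Real.exp ε * Real.exp (-v x)) * (Real.exp ε * ∫ y, Real.exp (-u y) ∂m) :=
        mul_le_mul h1 hZ hZv.le (by positivity)
    _ = _ := by ring

/-- The change of integrand costs s. The change of density is tested against G - g rather than G,
which is free because both densities have integral 1; so only the spread b of G enters. -/
theorem abs_boltzmann_average_sub_le {u v F G : X → ℝ} (hu : Measurable u) (hv : Measurable v)
    (hF : Measurable F) (hG : Measurable G) {M M' ε s b g : ℝ}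
    (huM : ∀ x, |u x| ≤ M) (hvM : ∀ x, |v x| ≤ M) (hFM : ∀ x, |F x| ≤ M') (hGM : ∀ x, |G x| ≤ M')
    (hε : 0 ≤ ε) (hε' : ε ≤ 1 / 2) (huv : ∀ᵐ x ∂m, |u x - v x| ≤ ε)
    (hFG : ∀ᵐ x ∂m, |F x - G x| ≤ s) (hb : 0 ≤ b) (hGb : ∀ᵐ x ∂m, |G x - g| ≤ b) :
    |(∫ x, F x * Real.exp (-u x) ∂m) / (∫ x, Real.exp (-u x) ∂m) -
      (∫ x, G x * Real.exp (-v x) ∂m) / (∫ x, Real.exp (-v x) ∂m)| ≤ s + 4 * b * ε := by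
  have hU := integrable_exp_neg (m := m) hu huM
  have hV := integrable_exp_neg (m := m) hv hvM
  have hZu := integral_exp_pos hU
  have hZv := integral_exp_pos hV
  set Zu := ∫ x, Real.exp (-u x) ∂m with hZu_def
  set Zv := ∫ x, Real.exp (-v x) ∂m with hZv_def
  set P : X → ℝ := fun x => Real.exp (-u x) / Zu with hP
  set Q : X → ℝ := fun x => Real.exp (-v x) / Zv with hQ
  have hP0 : ∀ x, 0 ≤ P x := fun x => div_nonneg (Real.exp_pos _).le hZu.le
  have hQ0 : ∀ x, 0 ≤ Q x := fun x => div_nonneg (Real.exp_pos _).le hZv.le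
  have hPi : Integrable P m := hU.div_const _
  have hQi : Integrable Q m := hV.div_const _
  have hP1 : ∫ x, P x ∂m = 1 := by rw [hP, integral_div, ← hZu_def, div_self hZu.ne']
  have hQ1 : ∫ x, Q x ∂m = 1 := by rw [hQ, integral_div, ← hZv_def, div_self hZv.ne']
  have hFP : Integrable (fun x => F x * P x) m :=
    hPi.bdd_mul hF.aestronglyMeasurable (ae_of_all _ hFM)
  have hGP : Integrable (fun x => G x * P x) m :=
    hPi.bdd_mul hG.aestronglyMeasurable (ae_of_all _ hGM)
  have hGQ : Integrable (fun x => G x * Q x) m :=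
    hQi.bdd_mul hG.aestronglyMeasurable (ae_of_all _ hGM)
  have e1 : (∫ x, F x * Real.exp (-u x) ∂m) / Zu = ∫ x, F x * P x ∂m := by
    rw [← integral_div]; simp only [hP, mul_div_assoc]
  have e2 : (∫ x, G x * Real.exp (-v x) ∂m) / Zv = ∫ x, G x * Q x ∂m := by
    rw [← integral_div]; simp only [hQ, mul_div_assoc]
  have e3 : ∫ x, F x * P x ∂m - ∫ x, G x * Q x ∂m =
      ∫ x, (F x - G x) * P x ∂m + ∫ x, (G x - g) * (P x - Q x) ∂m := by
    have h1 : ∫ x, (F x - G x) * P x ∂m = ∫ x, F x * P x ∂m - ∫ x, G x * P x ∂m := by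
      rw [← integral_sub hFP hGP]; simp only [sub_mul]
    have h2 : ∫ x, (G x - g) * (P x - Q x) ∂m =
        (∫ x, G x * P x ∂m - ∫ x, G x * Q x ∂m) -
          (∫ x, g * P x ∂m - ∫ x, g * Q x ∂m) := by
      rw [← integral_sub hGP hGQ, ← integral_sub (hPi.const_mul g) (hQi.const_mul g),
        ← integral_sub (f := fun x => G x * P x - G x * Q x)
          (g := fun x => g * P x - g * Q x) (hGP.sub hGQ)
          ((hPi.const_mul g).sub (hQi.const_mul g))]
      congr 1 with x
      ring
    rw [h1, h2, integral_const_mul, integral_const_mul, hP1, hQ1]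
    ring
  -- From |exp x - 1| ≤ 2|x| for |x| ≤ 1, at x = 2ε; hence the hypothesis ε ≤ 1/2.
  have hexp : Real.exp (2 * ε) - 1 ≤ 4 * ε := by
    have h2ε : |2 * ε| ≤ 1 := by rw [abs_le]; constructor <;> linarith
    have h := (abs_le.1 (Real.abs_exp_sub_one_le h2ε)).2
    rw [abs_of_nonneg (by linarith)] at h
    linarith
  have b1 : |∫ x, (F x - G x) * P x ∂m| ≤ s := by
    have h := norm_integral_le_of_norm_le (f := fun x => (F x - G x) * P x) (hPi.const_mul s)
      (by
        filter_upwards [hFG] with x hx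
        rw [norm_mul, Real.norm_of_nonneg (hP0 x)]
        exact mul_le_mul_of_nonneg_right hx (hP0 x))
    rwa [integral_const_mul, hP1, mul_one] at h
  have b2 : |∫ x, (G x - g) * (P x - Q x) ∂m| ≤ b * (4 * ε) := by
    have huv' : ∀ᵐ x ∂m, |v x - u x| ≤ ε := huv.mono fun x hx => by rwa [abs_sub_comm]
    have h := norm_integral_le_of_norm_le (f := fun x => (G x - g) * (P x - Q x))
      (hQi.const_mul (b * (4 * ε))) (by
        filter_upwards [hGb, exp_neg_div_le hu hv huM hvM huv,
          exp_neg_div_le hv hu hvM huM huv'] with x hx h1 h2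
        change P x ≤ Real.exp (2 * ε) * Q x at h1
        change Q x ≤ Real.exp (2 * ε) * P x at h2
        have hE : 1 ≤ Real.exp (2 * ε) := Real.one_le_exp (by linarith)
        have hPQ : |P x - Q x| ≤ 4 * ε * Q x := by
          have h3 : (Real.exp (2 * ε) - 1) * Q x ≤ 4 * ε * Q x :=
            mul_le_mul_of_nonneg_right hexp (hQ0 x)
          rw [abs_le]
          constructor
          · rcases le_total (P x) (Q x) with h4 | h4
            · have h5 : (Real.exp (2 * ε) - 1) * P x ≤ (Real.exp (2 * ε) - 1) * Q x :=
                mul_le_mul_of_nonneg_left h4 (by linarith)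
              linarith
            · have := mul_nonneg (mul_nonneg zero_le_four hε) (hQ0 x)
              linarith
          · linarith
        rw [norm_mul, mul_assoc]
        exact mul_le_mul hx hPQ (abs_nonneg _) hb)
    rwa [integral_const_mul, hQ1, mul_one] at h
  rw [e1, e2, e3]
  refine (abs_add_le _ _).trans ?_
  linarith

end Average

/-! ### Functions with summable single-site oscillations -/

/-- On `S`, the function `f` varies by at most `∑ b_j` over the sites `j` at which the
configurations differ. -/
def HasOsc {d : ℕ} (S : Set (CConf d)) (b : Site d → ℝ) (f : CConf d → ℝ) : Prop :=
  ∀ σ ∈ S, ∀ η ∈ S, |f σ - f η| ≤ ∑' j, {j | σ j ≠ η j}.indicator b j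

theorem tsum_indicator_le_of_nonneg {ι : Type*} {b : ι → ℝ} (hb : ∀ j, 0 ≤ b j)
    (hs : Summable b) (S : Set ι) : ∑' j, S.indicator b j ≤ ∑' j, b j :=
  (hs.indicator S).tsum_le_tsum (fun j => indicator_le_self' (fun j _ => hb j) j) hs

section SingleSite

variable {d q : ℕ} [NeZero q] {Φ : Potential d} {σ' : DConf d q}

theorem summable_update {ι : Type*} [DecidableEq ι] {b : ι → ℝ} (hb : Summable b) (i : ι) (c : ℝ) :
    Summable (update b i c) :=
  ((summable_congr_cofinite (f := update b i c) (g := b) (by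
    filter_upwards [(Set.finite_singleton i).compl_mem_cofinite] with j hj
    exact update_of_ne hj _ _)).2 hb)

theorem setOf_glue_ne (i : Site d) (ζ : ({i} : Finset (Site d)) → Circ) (σ η : CConf d) :
    {j | glue {i} ζ σ j ≠ glue {i} ζ η j} ⊆ {j | σ j ≠ η j} \ {i} := by
  intro j hj
  have hji : j ∉ ({i} : Finset (Site d)) := fun h => hj (by rw [glue_of_mem h, glue_of_mem h])
  refine ⟨?_, fun h => hji (by simpa using h)⟩
  simpa [glue_of_notMem hji] using hj

theorem tsum_indicator_glue_le (i : Site d) (ζ : ({i} : Finset (Site d)) → Circ) (σ η : CConf d)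
    {b : Site d → ℝ} (hb : ∀ j, 0 ≤ b j) (hs : Summable b) :
    ∑' j, {j | glue {i} ζ σ j ≠ glue {i} ζ η j}.indicator b j ≤
      ∑' j, {j | σ j ≠ η j}.indicator (update b i 0) j := by
  refine (hs.indicator _).tsum_le_tsum (fun j => ?_) ((summable_update hs i 0).indicator _)
  by_cases hj : j ∈ {j | glue {i} ζ σ j ≠ glue {i} ζ η j}
  · have h := setOf_glue_ne i ζ σ η hj
    rw [indicator_of_mem hj, indicator_of_mem h.1, update_of_ne h.2]
  · rw [indicator_of_notMem hj]
    refine indicator_nonneg (fun j _ => ?_) j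
    by_cases hji : j = i
    · subst hji; simp
    · rw [update_of_ne hji]; exact hb j

/-- Averaging over the spin at i removes the dependence on that spin and redistributes b_i to the
sites j that influence the conditional law at i, with weights 4 E_j. -/
theorem HasOsc.integral_gibbsMeasure {E : Site d → ℝ} {i : Site d}
    (hE0 : ∀ j, 0 ≤ E j) (hEs : Summable E) (hE1 : ∑' j, E j ≤ 1 / 2)
    (hE : HasOsc (constrainedSet σ') E (Φ.ham {i})) {f : CConf d → ℝ} (hf : Measurable f)
    {M : ℝ} (hM : ∀ σ, |f σ| ≤ M) {b : Site d → ℝ} (hb : ∀ j, 0 ≤ b j) (hbs : Summable b)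
    (hfb : HasOsc (constrainedSet σ') b f) :
    HasOsc (constrainedSet σ') (update (fun j => b j + 4 * b i * E j) i 0)
      fun η => ∫ σ, f σ ∂gibbsMeasure Φ σ' {i} η := by
  intro σ hσ η hη
  simp only [RotMix.integral_gibbsMeasure Φ σ' {i} hf]
  obtain ⟨C, hC⟩ := Φ.exists_abs_ham_le {i}
  have hEu : ∀ j, 0 ≤ update E i 0 j := fun j => by
    by_cases hji : j = i
    · subst hji; simp
    · rw [update_of_ne hji]; exact hE0 j
  have hζ := ae_arcPi σ' ({i} : Finset (Site d))
  obtain ⟨ζ₀, hζ₀⟩ := hζ.exists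
  have h := abs_boltzmann_average_sub_le (m := arcPi σ' ({i} : Finset (Site d)))
    (u := fun ζ => Φ.ham {i} (glue {i} ζ σ)) (v := fun ζ => Φ.ham {i} (glue {i} ζ η))
    (F := fun ζ => f (glue {i} ζ σ)) (G := fun ζ => f (glue {i} ζ η))
    ((Φ.measurable_ham _).comp (measurable_glue_left σ))
    ((Φ.measurable_ham _).comp (measurable_glue_left η))
    (hf.comp (measurable_glue_left σ)) (hf.comp (measurable_glue_left η))
    (fun _ => hC _) (fun _ => hC _) (fun _ => hM _) (fun _ => hM _)
    (ε := ∑' j, {j | σ j ≠ η j}.indicator (update E i 0) j)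
    (s := ∑' j, {j | σ j ≠ η j}.indicator (update b i 0) j) (b := b i)
    -- Any admissible spin ζ₀ serves as reference: with η fixed, only the spin at i varies, so f
    -- deviates from this value by at most b_i.
    (g := f (glue {i} ζ₀ η))
    (tsum_nonneg fun j => indicator_nonneg (fun j _ => hEu j) j)
    (by
      refine (tsum_indicator_le_of_nonneg hEu (summable_update hEs i 0) _).trans
        (le_trans ?_ hE1)
      refine (summable_update hEs i 0).tsum_le_tsum (fun j => ?_) hEs
      by_cases hji : j = i
      · subst hji; simpa using hE0 _
      · rw [update_of_ne hji])
    (by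
      filter_upwards [hζ] with ζ hζ
      exact (hE _ (glue_mem_constrainedSet hζ hσ) _ (glue_mem_constrainedSet hζ hη)).trans
        (tsum_indicator_glue_le i ζ σ η hE0 hEs))
    (by
      filter_upwards [hζ] with ζ hζ
      exact (hfb _ (glue_mem_constrainedSet hζ hσ) _ (glue_mem_constrainedSet hζ hη)).trans
        (tsum_indicator_glue_le i ζ σ η hb hbs))
    (hb i)
    (by
      filter_upwards [hζ] with ζ hζ
      refine (hfb _ (glue_mem_constrainedSet hζ hη) _ (glue_mem_constrainedSet hζ₀ hη)).trans ?_
      rw [tsum_eq_single i]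
      · exact indicator_le_self' (fun _ _ => hb i) i
      · intro j hji
        have hji' : j ∉ ({i} : Finset (Site d)) := by simpa using hji
        exact indicator_of_notMem
          (by simp [glue_of_notMem hji']) _)
  refine h.trans (le_of_eq ?_)
  rw [← tsum_mul_left, ← ((summable_update hbs i 0).indicator _).tsum_add
    (((summable_update hEs i 0).indicator _).mul_left _)]
  refine tsum_congr fun j => ?_
  by_cases hj : j ∈ {j | σ j ≠ η j}
  · simp only [indicator_of_mem hj]
    by_cases hji : j = i
    · subst hji; simp
    · simp only [update_of_ne hji]
  · simp only [indicator_of_notMem hj]; simp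

end SingleSite

/-! ### The Dobrushin comparison theorem -/

section Comparison

variable {d : ℕ}

/-- The vector `a` bounds the difference of the expectations under `μ` and `ν` in terms of the
single-site oscillations on `S`. -/
def IsEstimate (S : Set (CConf d)) (μ ν : Measure (CConf d)) (a : Site d → ℝ) : Prop :=
  ∀ f : CConf d → ℝ, Measurable f → (∃ M, ∀ σ, |f σ| ≤ M) → ∀ b : Site d → ℝ, (∀ j, 0 ≤ b j) →
    Summable b → HasOsc S b f → |∫ σ, f σ ∂μ - ∫ σ, f σ ∂ν| ≤ ∑' j, a j * b j

theorem summable_mul_of_le_one {ι : Type*} {a b : ι → ℝ} (ha : ∀ j, 0 ≤ a j) (ha1 : ∀ j, a j ≤ 1)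
    (hb : ∀ j, 0 ≤ b j) (hbs : Summable b) : Summable fun j => a j * b j :=
  hbs.of_nonneg_of_le (fun j => mul_nonneg (ha j) (hb j)) fun j =>
    mul_le_of_le_one_left (hb j) (ha1 j)

variable {S : Set (CConf d)} {μ ν : Measure (CConf d)}

theorem IsEstimate.mono {a a' : Site d → ℝ} (h : IsEstimate S μ ν a) (ha : ∀ j, 0 ≤ a j)
    (haa' : ∀ j, a j ≤ a' j) (ha' : ∀ j, a' j ≤ 1) : IsEstimate S μ ν a' :=
  fun f hf hM b hb hbs hfb => (h f hf hM b hb hbs hfb).trans <|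
    (summable_mul_of_le_one ha (fun j => (haa' j).trans (ha' j)) hb hbs).tsum_le_tsum
      (fun j => mul_le_mul_of_nonneg_right (haa' j) (hb j))
      (summable_mul_of_le_one (fun j => (ha j).trans (haa' j)) ha' hb hbs)

/-- The trivial estimate that starts the iteration: f varies by at most ∑ b_j on S. -/
theorem isEstimate_one [IsProbabilityMeasure μ] [IsProbabilityMeasure ν]
    (hμ : ∀ᵐ σ ∂μ, σ ∈ S) (hν : ∀ᵐ σ ∂ν, σ ∈ S) : IsEstimate S μ ν fun _ => 1 := by
  rintro f hf ⟨M, hM⟩ b hb hbs hfb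
  have hfμ : Integrable f μ := integrable_of_abs_le hf hM
  have hfν : Integrable f ν := integrable_of_abs_le hf hM
  have h1 : ∀ᵐ σ ∂μ, ‖f σ - ∫ η, f η ∂ν‖ ≤ ∑' j, b j := by
    filter_upwards [hμ] with σ hσ
    have e : f σ - ∫ η, f η ∂ν = ∫ η, (f σ - f η) ∂ν := by
      rw [integral_sub (integrable_const _) hfν]; simp
    rw [e]
    have h2 := norm_integral_le_of_norm_le_const (μ := ν) (f := fun η => f σ - f η)
      (C := ∑' j, b j) (by
        filter_upwards [hν] with η hη
        exact (hfb σ hσ η hη).trans (tsum_indicator_le_of_nonneg hb hbs _))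
    simpa using h2
  have e : ∫ σ, f σ ∂μ - ∫ σ, f σ ∂ν = ∫ σ, (f σ - ∫ η, f η ∂ν) ∂μ := by
    rw [integral_sub hfμ (integrable_const _)]; simp
  rw [e]
  simpa using norm_integral_le_of_norm_le_const h1

/-! ### Single-site invariance and iteration of estimates -/

variable {q : ℕ} [NeZero q] {Φ : Potential d} {σ' : DConf d q}

/-- The measure `μ` satisfies the DLR equation at the single site `i`. -/
def IsInvariantAt (Φ : Potential d) (σ' : DConf d q) (i : Site d) (μ : Measure (CConf d)) : Prop :=
  ∀ f : CConf d → ℝ, Measurable f → (∃ M, ∀ σ, |f σ| ≤ M) →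
    ∫ η, ∫ σ, f σ ∂gibbsMeasure Φ σ' {i} η ∂μ = ∫ σ, f σ ∂μ

/-- The properties of the influence matrix used in the comparison. -/
structure IsInfluence (Φ : Potential d) (σ' : DConf d q) (α : ℝ) (E : Site d → Site d → ℝ) :
    Prop where
  nonneg : ∀ i j, 0 ≤ E i j
  summable : ∀ i, Summable fun j => Real.exp (α * latDist i j) * E i j
  tsum_le : ∀ i, ∑' j, Real.exp (α * latDist i j) * E i j ≤ 1 / 8
  hasOsc : ∀ i, HasOsc (constrainedSet σ') (E i) (Φ.ham {i})

namespace IsInfluence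

variable {α : ℝ} {E : Site d → Site d → ℝ}

theorem summable_mul (hE : IsInfluence Φ σ' α E) {i : Site d} {w : Site d → ℝ} {c : ℝ}
    (hw : ∀ j, 0 ≤ w j) (hwc : ∀ j, w j ≤ Real.exp (α * latDist i j) * c) :
    Summable fun j => E i j * w j :=
  ((hE.summable i).mul_right c).of_nonneg_of_le (fun j => mul_nonneg (hE.nonneg _ _) (hw j))
    fun j => (mul_le_mul_of_nonneg_left (hwc j) (hE.nonneg i j)).trans (le_of_eq (by ring))

/-- The factor 4 from the single-site comparison and the row sum bound 1/8 combine to a contraction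
by 1/2. -/
theorem tsum_mul_le (hE : IsInfluence Φ σ' α E) {i : Site d} {w : Site d → ℝ} {c : ℝ}
    (hw : ∀ j, 0 ≤ w j) (hc : 0 ≤ c) (hwc : ∀ j, w j ≤ Real.exp (α * latDist i j) * c) :
    4 * ∑' j, E i j * w j ≤ c / 2 := by
  have h1 : ∑' j, E i j * w j ≤ ∑' j, Real.exp (α * latDist i j) * E i j * c :=
    (hE.summable_mul hw hwc).tsum_le_tsum
      (fun j => (mul_le_mul_of_nonneg_left (hwc j) (hE.nonneg i j)).trans (le_of_eq (by ring)))
      ((hE.summable i).mul_right c)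
  rw [tsum_mul_right] at h1
  have h2 := mul_le_mul_of_nonneg_right (hE.tsum_le i) hc
  linarith

theorem one_le_exp (hα : 0 ≤ α) (i j : Site d) : 1 ≤ Real.exp (α * latDist i j) :=
  Real.one_le_exp (mul_nonneg hα (latDist_nonneg _ _))

/-- Invariance at i allows f to be replaced by its average over the spin at i. Applying a to the
oscillations of the average and collecting the coefficient of b_i produces the new entry. -/
theorem update_isEstimate (hE : IsInfluence Φ σ' α E) (hα : 0 ≤ α) {i : Site d}
    (hμ : IsInvariantAt Φ σ' i μ) (hν : IsInvariantAt Φ σ' i ν) {a : Site d → ℝ}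
    (ha0 : ∀ j, 0 ≤ a j) (ha1 : ∀ j, a j ≤ 1) (ha : IsEstimate (constrainedSet σ') μ ν a) :
    IsEstimate (constrainedSet σ') μ ν (update a i (4 * ∑' j, E i j * a j)) := by
  rintro f hf ⟨M, hM⟩ b hb hbs hfb
  have h1e : ∀ j, (1 : ℝ) ≤ Real.exp (α * latDist i j) * 1 := fun j => by
    rw [mul_one]; exact one_le_exp hα i j
  have hEs : Summable (E i) := by
    simpa using hE.summable_mul (fun _ => zero_le_one) h1e
  have hE1 : ∑' j, E i j ≤ 1 / 2 := by
    have h := hE.tsum_mul_le (fun _ => zero_le_one) zero_le_one h1e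
    simp only [mul_one] at h
    have h0 : 0 ≤ ∑' j, E i j := tsum_nonneg (hE.nonneg i)
    linarith
  have hEa : Summable fun j => E i j * a j :=
    hE.summable_mul ha0 fun j => (ha1 j).trans (h1e j)
  have hosc := HasOsc.integral_gibbsMeasure (hE.nonneg i) hEs hE1 (hE.hasOsc i) hf hM hb hbs hfb
  set b' : Site d → ℝ := update (fun j => b j + 4 * b i * E i j) i 0 with hb'
  have hb'0 : ∀ j, 0 ≤ b' j := fun j => by
    by_cases hji : j = i
    · subst hji; simp [hb']
    · rw [hb', update_of_ne hji]
      exact add_nonneg (hb j) (mul_nonneg (mul_nonneg zero_le_four (hb i)) (hE.nonneg i j))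
  have hb's : Summable b' := summable_update (hbs.add (hEs.mul_left _)) i 0
  have hmeas : Measurable fun η => ∫ σ, f σ ∂gibbsMeasure Φ σ' {i} η :=
    (hf.stronglyMeasurable.integral_kernel (κ := gibbsKernel Φ σ' {i})).measurable
  have hbdd : ∀ η, |∫ σ, f σ ∂gibbsMeasure Φ σ' {i} η| ≤ M := fun η => by
    simpa using norm_integral_le_of_norm_le_const (μ := gibbsMeasure Φ σ' {i} η) (f := f)
      (ae_of_all _ hM)
  have h := ha _ hmeas ⟨M, hbdd⟩ b' hb'0 hb's hosc
  rw [hμ f hf ⟨M, hM⟩, hν f hf ⟨M, hM⟩] at h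
  refine h.trans ?_
  have hab : Summable fun j => a j * b j := summable_mul_of_le_one ha0 ha1 hb hbs
  have hab' := summable_update hab i 0
  have hR : (fun j => update a i (4 * ∑' j, E i j * a j) j * b j) =
      update (fun j => a j * b j) i ((4 * ∑' j, E i j * a j) * b i) := by
    funext j
    by_cases hji : j = i
    · subst hji; simp
    · simp [update_of_ne hji]
  have hsum : ∑' j, update (fun j => a j * b j) i ((4 * ∑' j, E i j * a j) * b i) j =
      ∑' j, update (fun j => a j * b j) i 0 j + (4 * ∑' j, E i j * a j) * b i := by
    rw [(summable_update hab i _).tsum_eq_add_tsum_ite i, hab'.tsum_eq_add_tsum_ite i,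
      update_self, update_self, zero_add, add_comm]
    congr 1
    refine tsum_congr fun j => ?_
    split_ifs with hji
    · rfl
    · rw [update_of_ne hji, update_of_ne hji]
  rw [hR, hsum]
  have hterm : ∀ j, a j * b' j ≤
      update (fun j => a j * b j) i 0 j + 4 * b i * (E i j * a j) := fun j => by
    by_cases hji : j = i
    · subst hji
      simp only [hb', update_self, mul_zero, zero_add]
      exact mul_nonneg (mul_nonneg zero_le_four (hb _)) (mul_nonneg (hE.nonneg _ _) (ha0 _))
    · rw [hb', update_of_ne hji, update_of_ne hji]
      exact le_of_eq (by ring)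
  calc ∑' j, a j * b' j
      ≤ ∑' j, (update (fun j => a j * b j) i 0 j + 4 * b i * (E i j * a j)) :=
        (summable_mul_of_le_one ha0 ha1 hb'0 hb's).tsum_le_tsum hterm
          (hab'.add (hEa.mul_left _))
    _ = _ := by rw [hab'.tsum_add (hEa.mul_left _), tsum_mul_left]; ring

-- Sites are updated one at a time, giving an estimate equal to t on a finite set F and to a
-- elsewhere. These vectors stay below a, so the bound `hEt` applies at each stage; dominated
-- convergence then lets F exhaust the lattice.
open Classical in
theorem improve_isEstimate (hE : IsInfluence Φ σ' α E) (hα : 0 ≤ α) {Δ : Set (Site d)}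
    (hμ : ∀ i ∈ Δ, IsInvariantAt Φ σ' i μ) (hν : ∀ i ∈ Δ, IsInvariantAt Φ σ' i ν)
    {a t : Site d → ℝ} (ha1 : ∀ j, a j ≤ 1) (ht0 : ∀ j, 0 ≤ t j)
    (hta : ∀ j, t j ≤ a j) (hEt : ∀ i ∈ Δ, 4 * ∑' j, E i j * a j ≤ t i)
    (hat : ∀ i ∉ Δ, a i ≤ t i)
    (ha : IsEstimate (constrainedSet σ') μ ν a) : IsEstimate (constrainedSet σ') μ ν t := by
  have ha0 : ∀ j, 0 ≤ a j := fun j => (ht0 j).trans (hta j)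
  have h1e : ∀ i j : Site d, (1 : ℝ) ≤ Real.exp (α * latDist i j) * 1 := fun i j => by
    rw [mul_one]; exact one_le_exp hα i j
  set v : Finset (Site d) → Site d → ℝ := fun F j => if j ∈ F then t j else a j with hv
  have hv0 : ∀ F j, 0 ≤ v F j := fun F j => by simp only [hv]; split_ifs; exacts [ht0 j, ha0 j]
  have hva : ∀ F j, v F j ≤ a j := fun F j => by
    simp only [hv]; split_ifs; exacts [hta j, le_rfl]
  have hv1 : ∀ F j, v F j ≤ 1 := fun F j => (hva F j).trans (ha1 j)
  have hest : ∀ F : Finset (Site d), IsEstimate (constrainedSet σ') μ ν (v F) := fun F => by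
    induction F using Finset.induction_on with
    | empty => simpa [hv] using ha
    | insert i F hi ih =>
      by_cases hiΔ : i ∈ Δ
      · have h := hE.update_isEstimate hα (hμ i hiΔ) (hν i hiΔ) (hv0 F) (hv1 F) ih
        refine h.mono (fun j => ?_) (fun j => ?_) (hv1 _)
        · by_cases hji : j = i
          · subst hji
            rw [update_self]
            exact mul_nonneg zero_le_four
              (tsum_nonneg fun k => mul_nonneg (hE.nonneg _ _) (hv0 F k))
          · rw [update_of_ne hji]; exact hv0 F j
        · by_cases hji : j = i
          · subst hji
            rw [update_self]
            simp only [hv, Finset.mem_insert_self, if_true]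
            refine le_trans ?_ (hEt j hiΔ)
            refine mul_le_mul_of_nonneg_left (Summable.tsum_le_tsum
              (fun k => mul_le_mul_of_nonneg_left (hva F k) (hE.nonneg j k)) ?_ ?_) zero_le_four
            · exact hE.summable_mul (hv0 F) fun k => (hv1 F k).trans (h1e j k)
            · exact hE.summable_mul ha0 fun k => (ha1 k).trans (h1e j k)
          · rw [update_of_ne hji]
            simp only [hv, Finset.mem_insert, hji, false_or, le_refl]
      · refine ih.mono (hv0 F) (fun j => ?_) (hv1 _)
        by_cases hji : j = i
        · subst hji
          simp only [hv, Finset.mem_insert_self, if_true, hi, if_false]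
          exact hat j hiΔ
        · simp only [hv, Finset.mem_insert, hji, false_or, le_refl]
  intro f hf hM b hb hbs hfb
  have hlim : Tendsto (fun F => ∑' j, v F j * b j) atTop (𝓝 (∑' j, t j * b j)) := by
    refine tendsto_tsum_of_dominated_convergence hbs (fun j => ?_)
      (Eventually.of_forall fun F j => ?_)
    · refine tendsto_const_nhds.congr' ?_
      filter_upwards [eventually_ge_atTop ({j} : Finset (Site d))] with F hF
      simp [hv, hF (Finset.mem_singleton_self j)]
    · rw [Real.norm_of_nonneg (mul_nonneg (hv0 F j) (hb j))]
      exact mul_le_of_le_one_left (hb j) (hv1 F j)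
  exact ge_of_tendsto' hlim fun F => hest F f hf hM b hb hbs hfb

/-- The Dobrushin comparison theorem with exponential weights: if `μ` and `ν` satisfy the
single-site DLR equations in `Δ`, then their expectations differ by at most `∑ w_j b_j`, for a
weight `w` that is at least `1` outside `Δ` and changes by at most an exponential factor. -/
theorem isEstimate_min (hE : IsInfluence Φ σ' α E) (hα : 0 ≤ α) {Δ : Set (Site d)}
    [IsProbabilityMeasure μ] [IsProbabilityMeasure ν]
    (hμS : ∀ᵐ σ ∂μ, σ ∈ constrainedSet σ') (hνS : ∀ᵐ σ ∂ν, σ ∈ constrainedSet σ')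
    (hμ : ∀ i ∈ Δ, IsInvariantAt Φ σ' i μ) (hν : ∀ i ∈ Δ, IsInvariantAt Φ σ' i ν)
    {w : Site d → ℝ} (hw0 : ∀ j, 0 ≤ w j) (hw1 : ∀ i ∉ Δ, 1 ≤ w i)
    (hw : ∀ i j, w j ≤ Real.exp (α * latDist i j) * w i) (n : ℕ) :
    IsEstimate (constrainedSet σ') μ ν fun j => min 1 ((1 / 2) ^ n + w j) := by
  have hp : ∀ n : ℕ, (0 : ℝ) ≤ (1 / 2) ^ n := fun n => by positivity
  have h0 : ∀ (n : ℕ) (j : Site d), 0 ≤ min 1 ((1 / 2 : ℝ) ^ n + w j) := fun n j =>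
    le_min zero_le_one (add_nonneg (hp n) (hw0 j))
  induction n with
  | zero =>
    refine (isEstimate_one hμS hνS).mono (fun _ => zero_le_one) (fun j => le_min le_rfl ?_)
      fun j => min_le_left _ _
    simpa using hw0 j
  | succ n ih =>
    refine hE.improve_isEstimate hα hμ hν (fun j => min_le_left _ _) (h0 _)
      (fun j => ?_) (fun i _ => ?_) (fun i hi => ?_) ih
    · refine min_le_min le_rfl (add_le_add ?_ le_rfl)
      rw [pow_succ]
      have := hp n
      linarith
    · have hc1 : ∀ j, min 1 ((1 / 2 : ℝ) ^ n + w j) ≤ Real.exp (α * latDist i j) * 1 := fun j => by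
        rw [mul_one]; exact (min_le_left _ _).trans (one_le_exp hα i j)
      have hc2 : ∀ j, min 1 ((1 / 2 : ℝ) ^ n + w j) ≤
          Real.exp (α * latDist i j) * ((1 / 2) ^ n + w i) := fun j => by
        rw [mul_add]
        exact (min_le_right _ _).trans
          (add_le_add (le_mul_of_one_le_left (hp n) (one_le_exp hα i j)) (hw i j))
      have h1 := hE.tsum_mul_le (h0 n) zero_le_one hc1
      have h2 := hE.tsum_mul_le (h0 n) (add_nonneg (hp n) (hw0 i)) hc2
      refine le_min (by linarith) ?_
      rw [pow_succ]
      have := hw0 i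
      linarith
    -- Off Δ no update is available, but w_i ≥ 1 makes the target entry already 1.
    · exact (min_le_left _ _).trans (le_min le_rfl ((hw1 i hi).trans (by
        have := hp (n + 1); linarith)))

/-- The indicator of an event in Λ has oscillation at most 1 at each site of Λ and 0 elsewhere; then
n → ∞. -/
theorem abs_real_sub_le (hE : IsInfluence Φ σ' α E) (hα : 0 ≤ α) {Δ : Set (Site d)}
    [IsProbabilityMeasure μ] [IsProbabilityMeasure ν]
    (hμS : ∀ᵐ σ ∂μ, σ ∈ constrainedSet σ') (hνS : ∀ᵐ σ ∂ν, σ ∈ constrainedSet σ')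
    (hμ : ∀ i ∈ Δ, IsInvariantAt Φ σ' i μ) (hν : ∀ i ∈ Δ, IsInvariantAt Φ σ' i ν)
    {w : Site d → ℝ} (hw0 : ∀ j, 0 ≤ w j) (hw1 : ∀ i ∉ Δ, 1 ≤ w i)
    (hw : ∀ i j, w j ≤ Real.exp (α * latDist i j) * w i) {Λ : Finset (Site d)}
    {A : Set (CConf d)} (hA : MeasurableSet A)
    (hAΛ : ∀ σ η : CConf d, (∀ i ∈ Λ, σ i = η i) → (σ ∈ A ↔ η ∈ A)) :
    |μ.real A - ν.real A| ≤ ∑ i ∈ Λ, w i := by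
  set b : Site d → ℝ := (Λ : Set (Site d)).indicator 1 with hb
  have hb0 : ∀ j, 0 ≤ b j := fun j => indicator_nonneg (fun _ _ => zero_le_one) j
  have hbΛ : ∀ j ∈ Λ, b j = 1 := fun j hj => by simp [hb, hj]
  have hbs : Summable b := summable_of_ne_finset_zero (s := Λ) fun j hj => by simp [hb, hj]
  have hosc : HasOsc (constrainedSet σ') b (A.indicator 1) := by
    intro σ _ η _
    have hnn : ∀ j, 0 ≤ {j | σ j ≠ η j}.indicator b j := fun j =>
      indicator_nonneg (fun j _ => hb0 j) j
    by_cases hση : ∃ i ∈ Λ, σ i ≠ η i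
    · obtain ⟨i, hi, hne⟩ := hση
      have h1 : (1 : ℝ) ≤ ∑' j, {j | σ j ≠ η j}.indicator b j := by
        refine le_trans ?_ ((hbs.indicator _).le_tsum i fun j _ => hnn j)
        rw [indicator_of_mem (show i ∈ {j | σ j ≠ η j} from hne), hbΛ i hi]
      refine le_trans ?_ h1
      by_cases h2 : σ ∈ A <;> by_cases h3 : η ∈ A <;> simp [h2, h3]
    · push Not at hση
      have h2 := hAΛ σ η hση
      have h3 : A.indicator (1 : CConf d → ℝ) σ = A.indicator 1 η := by
        by_cases h4 : η ∈ A
        · simp [h4, h2.2 h4]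
        · simp [h4, mt h2.1 h4]
      rw [h3, sub_self, abs_zero]
      exact tsum_nonneg hnn
  have key : ∀ n : ℕ, |μ.real A - ν.real A| ≤ ∑ i ∈ Λ, ((1 / 2) ^ n + w i) := fun n => by
    have h := hE.isEstimate_min hα hμS hνS hμ hν hw0 hw1 hw n (A.indicator 1)
      (measurable_one.indicator hA)
      ⟨1, fun σ => by by_cases h : σ ∈ A <;> simp [h]⟩ b hb0 hbs hosc
    rw [integral_indicator_one hA, integral_indicator_one hA, tsum_eq_sum (s := Λ)
      fun j hj => by simp [hb, hj]] at h
    refine h.trans (Finset.sum_le_sum fun i hi => ?_)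
    rw [hbΛ i hi, mul_one]
    exact min_le_right _ _
  have hlim : Tendsto (fun n : ℕ => ∑ i ∈ Λ, ((1 / 2 : ℝ) ^ n + w i)) atTop
      (𝓝 (∑ i ∈ Λ, (0 + w i))) :=
    tendsto_finsetSum _ fun i _ =>
      (tendsto_pow_atTop_nhds_zero_of_lt_one (by norm_num) (by norm_num)).add_const _
  simpa using ge_of_tendsto' hlim key

end IsInfluence

end Comparison

/-! ### Uniqueness and mixing -/

section Main

variable {d q : ℕ} [NeZero q] {Φ : Potential d} {σ' : DConf d q}

/-- Configurations in the same arcs are sitewise 2π/q-close whatever σ' is, so one matrix serves all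
σ'. -/
theorem isInfluence_infl {α : ℝ} (hα : 0 ≤ α) (hΦ : Φ.ExpSummable α)
    (hq : Φ.oscSum α (2 * Real.pi / q) ≤ 1 / 8) (σ' : DConf d q) :
    IsInfluence Φ σ' α (Φ.infl (2 * Real.pi / q)) where
  nonneg := Φ.infl_nonneg _
  summable := hΦ.summable_exp_mul_infl _
  tsum_le i := (hΦ.tsum_exp_mul_infl _ i).trans_le hq
  hasOsc i _ hσ _ hη := hΦ.abs_ham_sub_le hα i fun j =>
    dist_le_of_coarse_eq ((hσ j).trans (hη j).symm)

theorem IsConstrainedGibbs.isInvariantAt {μ : Measure (CConf d)}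
    (hμ : IsConstrainedGibbs Φ q σ' μ) (i : Site d) : IsInvariantAt Φ σ' i μ := by
  rintro f hf ⟨M, hM⟩
  obtain ⟨h1, -, h3⟩ := (isConstrainedGibbs_iff Φ σ').1 hμ
  conv_rhs => rw [← h3 {i}]
  have : IsFiniteMeasure (μ.bind (gibbsKernel Φ σ' {i})) := by rw [h3]; infer_instance
  rw [integral_bind_kernel (integrable_of_abs_le hf hM)]
  rfl

/-- Since B does not involve the spin at i, its indicator passes through the kernel at i. -/
theorem IsInvariantAt.cond {μ : Measure (CConf d)} {i : Site d} (hμ : IsInvariantAt Φ σ' i μ)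
    {B : Set (CConf d)} (hB : MeasurableSet B)
    (hBi : ∀ σ η : CConf d, (∀ j ≠ i, σ j = η j) → (σ ∈ B ↔ η ∈ B)) :
    IsInvariantAt Φ σ' i (μ[|B]) := by
  rintro f hf ⟨M, hM⟩
  have h := hμ (B.indicator f) (hf.indicator hB) ⟨M, fun σ => by
    by_cases hσ : σ ∈ B
    · simpa [hσ] using hM σ
    · simpa [hσ] using (abs_nonneg _).trans (hM σ)⟩
  have h1 : ∀ η, ∫ σ, B.indicator f σ ∂gibbsMeasure Φ σ' {i} η =
      B.indicator (fun η => ∫ σ, f σ ∂gibbsMeasure Φ σ' {i} η) η := fun η => by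
    have hg : ∀ ζ, glue {i} ζ η ∈ B ↔ η ∈ B := fun ζ =>
      hBi _ _ fun j hj => glue_of_notMem (by simpa using hj)
    rw [integral_gibbsMeasure Φ σ' {i} (hf.indicator hB)]
    by_cases hη : η ∈ B
    · rw [indicator_of_mem hη, integral_gibbsMeasure Φ σ' {i} hf]
      simp only [indicator_of_mem ((hg _).2 hη)]
    · rw [indicator_of_notMem hη]
      simp only [indicator_of_notMem (mt (hg _).1 hη)]
      simp
  simp only [h1] at h
  rw [integral_indicator hB, integral_indicator hB] at h
  rw [ProbabilityTheory.cond, integral_smul_measure, integral_smul_measure, h]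

/-- With Δ the whole lattice there is no condition w ≥ 1, so w = 0 is admissible and the measures
agree on cylinders. -/
theorem IsConstrainedGibbs.unique {α : ℝ} {E : Site d → Site d → ℝ}
    (hE : IsInfluence Φ σ' α E) (hα : 0 ≤ α) {μ ν : Measure (CConf d)}
    (hμ : IsConstrainedGibbs Φ q σ' μ) (hν : IsConstrainedGibbs Φ q σ' ν) : μ = ν := by
  have := hμ.isProbabilityMeasure
  have := hν.isProbabilityMeasure
  refine ext_of_generate_finite _ generateFrom_measurableCylinders.symm
    isPiSystem_measurableCylinders (fun A hA => ?_) (by simp)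
  have hAm := MeasurableSet.of_mem_measurableCylinders hA
  obtain ⟨Λ, S, -, rfl⟩ := (mem_measurableCylinders A).1 hA
  have h := hE.abs_real_sub_le hα (Δ := univ) hμ.constrained hν.constrained
    (fun i _ => hμ.isInvariantAt i) (fun i _ => hν.isInvariantAt i) (w := fun _ => 0)
    (fun _ => le_rfl) (fun i hi => absurd (mem_univ i) hi) (fun _ _ => by simp) (Λ := Λ) hAm
    (fun σ η hση => by
      have hr : Λ.restrict σ = Λ.restrict η := funext fun i => hση i.1 i.2
      simp only [mem_cylinder, hr])
  rw [Finset.sum_const_zero, abs_nonpos_iff, sub_eq_zero] at h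
  rwa [← measureReal_eq_measureReal_iff]

theorem mem_iff_of_measurableSet_cylinderEvents {ι : Type*} {X : ι → Type*}
    [∀ i, MeasurableSpace (X i)] {S : Set ι} {B : Set (∀ i, X i)}
    (hB : MeasurableSet[cylinderEvents S] B) {x y : ∀ i, X i} (h : ∀ i ∈ S, x i = y i) :
    x ∈ B ↔ y ∈ B := by
  have hle : cylinderEvents S ≤ MeasurableSpace.comap (fun (x : ∀ i, X i) (i : S) => x i)
      MeasurableSpace.pi := by
    refine iSup₂_le fun i hi => ?_
    rintro _ ⟨s, hs, rfl⟩
    exact ⟨(fun z : ∀ i : S, X i => z ⟨i, hi⟩) ⁻¹' s, measurable_pi_apply _ hs, rfl⟩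
  obtain ⟨B', -, rfl⟩ := hle B hB
  have hxy : (fun i : S => x i) = fun i : S => y i := funext fun i => h i.1 i.2
  simp only [mem_preimage, hxy]

/-- Conditioning on an event outside `Δ` changes the probability of an event in `Λ` at most by the
exponential weight of the pairs of sites in `Λ × Δᶜ`. -/
theorem IsConstrainedGibbs.abs_cond_sub_le {α : ℝ} (hα : 0 < α) {E : Site d → Site d → ℝ}
    (hE : IsInfluence Φ σ' α E) {μ : Measure (CConf d)} (hμ : IsConstrainedGibbs Φ q σ' μ)
    {Λ Δ : Finset (Site d)} {A B : Set (CConf d)} (hA : MeasurableSet A) (hB : MeasurableSet B)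
    (hAΛ : ∀ σ η : CConf d, (∀ i ∈ Λ, σ i = η i) → (σ ∈ A ↔ η ∈ A))
    (hBΔ : ∀ σ η : CConf d, (∀ i ∉ Δ, σ i = η i) → (σ ∈ B ↔ η ∈ B)) (hB0 : μ B ≠ 0) :
    |(μ[|B]).real A - μ.real A| ≤
      ∑ i ∈ Λ, ∑' j : {j : Site d // j ∉ Δ}, Real.exp (-α * latDist i j.1) := by
  have := hμ.isProbabilityMeasure
  have := cond_isProbabilityMeasure hB0
  have hs : ∀ i : Site d,
      Summable fun j : {j : Site d // j ∉ Δ} => Real.exp (-α * latDist i j.1) := fun i =>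
    (summable_exp_latDist hα i).comp_injective Subtype.val_injective
  -- The weight is w_i = ∑_{j ∉ Δ} exp(-α|i-j|): for i ∉ Δ the term j = i is already 1, and the
  -- triangle inequality controls how w varies between sites.
  refine hE.abs_real_sub_le hα.le (Δ := {i | i ∈ Δ}) ?_ hμ.constrained (fun i hi => ?_)
    (fun i _ => hμ.isInvariantAt i) (fun i => tsum_nonneg fun j => (Real.exp_pos _).le)
    (fun i hi => ?_) (fun i k => ?_) hA hAΛ
  · exact cond_absolutelyContinuous.ae_le hμ.constrained
  · exact (hμ.isInvariantAt i).cond hB fun σ η h =>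
      hBΔ σ η fun j hj => h j fun hji => hj (hji ▸ hi)
  · have h := (hs i).le_tsum ⟨i, hi⟩ fun j _ => (Real.exp_pos _).le
    simpa using h
  · rw [← tsum_mul_left]
    refine (hs k).tsum_le_tsum (fun j => ?_) ((hs i).mul_left _)
    rw [← Real.exp_add]
    refine Real.exp_le_exp.2 ?_
    have := mul_le_mul_of_nonneg_left (latDist_triangle i k j.1) hα.le
    linarith

/-- Rotation followed by discretization acts sitewise, so events pull back to events with the same
supports and the continuous-spin bound applies unchanged. -/
theorem uniformlyMixingInFuture_updateKernel {α : ℝ} (hα : 0 < α)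
    {E : DConf d q → Site d → Site d → ℝ} (hE : ∀ σ', IsInfluence Φ σ' α (E σ')) (τ : ℝ) :
    UniformlyMixingInFuture (updateKernel Φ q τ) α := by
  refine ⟨1, one_pos, fun σ' Λ Δ _ A B hA hB hB0 => ?_⟩
  have hμ : IsConstrainedGibbs Φ q σ' (constrainedGibbs Φ q σ') :=
    Classical.epsilon_spec (exists_isConstrainedGibbs Φ σ')
  have hT : Measurable fun (σ : CConf d) i => coarse q (σ i + (τ : Circ)) :=
    measurable_pi_lambda _ fun i =>
      (measurable_coarse q).comp ((measurable_pi_apply i).add_const _)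
  have hA' := cylinderEvents_le_pi _ hA
  have hB' := cylinderEvents_le_pi _ hB
  set T : CConf d → DConf d q := fun σ i => coarse q (σ i + (τ : Circ)) with hT_def
  have hcond : ((updateKernel Φ q τ σ')[|B]).real A =
      ((constrainedGibbs Φ q σ')[|T ⁻¹' B]).real (T ⁻¹' A) := by
    rw [measureReal_def, measureReal_def, cond_apply hB', cond_apply (hT hB'), updateKernel,
      Measure.map_apply hT hB', Measure.map_apply hT (hB'.inter hA'), preimage_inter]
  have hreal : (updateKernel Φ q τ σ').real A = (constrainedGibbs Φ q σ').real (T ⁻¹' A) := by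
    rw [measureReal_def, measureReal_def, updateKernel, Measure.map_apply hT hA']
  rw [updateKernel, Measure.map_apply hT hB'] at hB0
  rw [hcond, hreal, one_mul]
  refine hμ.abs_cond_sub_le hα (hE σ') (hT hA') (hT hB') (fun σ η h => ?_) (fun σ η h => ?_) hB0
  · exact mem_iff_of_measurableSet_cylinderEvents hA fun i hi => by
      simp only [hT_def, h i hi]
  · exact mem_iff_of_measurableSet_cylinderEvents hB fun i hi => by
      simp only [hT_def, h i hi]

end Main

end RotMix

theorem mainTheorem8 (d : ℕ) (Φ : RotMix.Potential d) (α₂ : ℝ) (hα₂ : 0 < α₂)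
    (hΦ : Φ.ExpSummable α₂) :
    ∃ q₀ : ℕ, ∀ (q : ℕ) [NeZero q], q₀ ≤ q →
      (∀ σ' : RotMix.DConf d q, ∃! μ, RotMix.IsConstrainedGibbs Φ q σ' μ) ∧
      ∀ τ : ℝ, 0 ≤ τ → τ < 2 * Real.pi →
        RotMix.UniformlyMixingInFuture (RotMix.updateKernel Φ q τ) α₂ := by
  obtain ⟨q₀, hq₀⟩ := Filter.eventually_atTop.1
    (hΦ.tendsto_oscSum.eventually_le_const (show (0 : ℝ) < 1 / 8 by norm_num))
  refine ⟨q₀, fun q _ hq => ⟨fun σ' => ?_, fun τ _ _ => ?_⟩⟩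
  · obtain ⟨μ, hμ⟩ := RotMix.exists_isConstrainedGibbs Φ σ'
    exact ⟨μ, hμ, fun ν hν =>
      hν.unique (RotMix.isInfluence_infl hα₂.le hΦ (hq₀ q hq) σ') hα₂.le hμ⟩
  · exact RotMix.uniformlyMixingInFuture_updateKernel hα₂
      (RotMix.isInfluence_infl hα₂.le hΦ (hq₀ q hq)) τ
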